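/- **Theorem 2 (Toda equations for generalized Jacobi weights).** Let $m\ge 2$, let $\alpha_1,\dots,\alpha_m\in\mathbb C$ be constants, and let $x_1(t),\dots,x_m(t)\in\mathbb C$ be pairwise distinct points depending in a $C^1$ way on a (real or complex) parameter $t$ in an open set $T$. Let $$\mathcal L_t(\varphi)=\sum_j A_j\int_{S_j(t)}\varphi(z)\prod_{k=1}^m (z-x_k(t))^{\alpha_k}\,dz ,\qquad \mu_n(t)=\mathcal L_t(z^n),$$ where the sum is finite and the constants $A_j\in\mathbb C$ do not depend on $t$. Each $S_j(t)$ is either an arc joining two of the points $x_k(t)$ (the same two for all $t$), avoiding the points $x_k(t)$ in between, with nonzero tangents at its ends, where $\operatorname{Re}\alpha_k>-1$ at these two points; or a closed contour avoiding the points $x_k(t)$ along which the weight is single-valued. The curves are $C^1$, they and their velocities depend in a $C^1$ way on $t$, and the branches of $\log(z-x_k(t))$ used for the powers are continuous in $t$ and along each curve. Assume that for every $t\in T$ there are polynomials $p_n=p_n(\cdot\,;t)$ of exact degree $n$, $n\ge0$, with $\mathcal L_t(p_np_k)=\delta_{n,k}$, let $a_n,b_n$ be their recurrence coefficients, $$a_{n+1}p_{n+1}(z)=(z-b_n)p_n(z)-a_np_{n-1}(z)\qquad(n\ge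 0,\ p_{-1}=0),$$ and let the signs of the $p_n$ be chosen so that the $a_n$ ($n\ge1$) are continuous in $t$. Put $W(z)=\prod_{k}(z-x_k)$, $2V(z)=W(z)\sum_k\alpha_k/(z-x_k)$ and $f(z)=\sum_{k\ge0}\mu_kz^{-k-1}$ (formal series); let $U$ be the polynomial part of $Wf'-2Vf$, and $p^{(1)}_{n-1}$ the polynomial part of $fp_n$. Set $$\Theta_n=W\big[p_{n-1}^{(1)}{}'p_n-p_n'p_{n-1}^{(1)}\big]-2Vp_{n-1}^{(1)}p_n-Up_n^2 ,$$ $$\Omega_n=a_nW\big[p_{n-1}^{(1)}{}'p_{n-1}-p_n'p_{n-2}^{(1)}\big]-a_nV\big[p_{n-1}^{(1)}p_{n-1}+p_np_{n-2}^{(1)}\big]-a_nUp_np_{n-1}\quad(n\ge1),\qquad \Omega_0=V .$$ Then, for every $t\in T$, one has $Wf'=2Vf+U$; $a_n\neq0$ and $a_n$ is differentiable in $t$ for $n\ge1$, $b_n$ is differentiable in $t$ for $n\ge0$; and $$\frac{\dot a_n}{a_n}=\frac12\sum_{k=1}^m\frac{(\Theta_n(x_k)-\Theta_{n-1}(x_k))\,\dot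 x_k}{W'(x_k)}\quad(n\ge1),\qquad \dot b_n=\sum_{k=1}^m\frac{(\Omega_{n+1}(x_k)-\Omega_n(x_k))\,\dot x_k}{W'(x_k)}\quad(n\ge0),$$ where the dot is $d/dt$ and the prime is $d/dz$. -/

import Mathlib

open Polynomial

/-! ### Formal series at infinity

A sequence `c : ℕ → ℂ` stands for the formal series `∑ₖ c k * z ^ (-k-1)`.  The moment series
`f(z) = ∑ₖ μ k * z ^ (-k-1)` is the one of the moment sequence `μ`. -/

namespace Toda

/-- The linear form on polynomials with moments `μ`, i.e. `z ^ k ↦ μ k`. -/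
noncomputable def linForm (μ : ℕ → ℂ) (P : ℂ[X]) : ℂ :=
  P.sum fun k a => a * μ k

/-- Coefficients of the derivative `f'` of the series `f` of `μ`:
`f'(z) = ∑ₖ -(k+1) * μ k * z ^ (-(k+1)-1)`. -/
def derivCoeff (μ : ℕ → ℂ) : ℕ → ℂ
  | 0 => 0
  | k + 1 => -((k : ℂ) + 1) * μ k

/-- The polynomial part of the product of the polynomial `P` with the series of `c`. -/
noncomputable def polyPart (c : ℕ → ℂ) (P : ℂ[X]) : ℂ[X] :=
  P.sum fun n a => ∑ k ∈ Finset.range n, C (a * c k) * X ^ (n - 1 - k)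

/-- The coefficient of `z ^ (-j-1)` in the product of the polynomial `P` with the series of `c`. -/
noncomputable def negCoeff (c : ℕ → ℂ) (P : ℂ[X]) (j : ℕ) : ℂ :=
  P.sum fun n a => a * c (n + j)

/-! ### The polynomials `W`, `V`, `U`, `Θₙ`, `Ωₙ` -/

/-- `W(z) = ∏ₖ (z - xₖ)`. -/
noncomputable def W {m : ℕ} (x : Fin m → ℂ) : ℂ[X] :=
  ∏ k, (X - C (x k))

/-- `V`, where `2 V(z) = W(z) ∑ₖ αₖ / (z - xₖ)`. -/
noncomputable def V {m : ℕ} (x α : Fin m → ℂ) : ℂ[X] :=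
  C (1 / 2) * ∑ k, C (α k) * ∏ l ∈ Finset.univ.erase k, (X - C (x l))

/-- The polynomial part of `W f' - 2 V f`. -/
noncomputable def U {m : ℕ} (x α : Fin m → ℂ) (μ : ℕ → ℂ) : ℂ[X] :=
  polyPart (derivCoeff μ) (W x) - polyPart μ (2 * V x α)

/-- The formal identity `W f' = 2 V f + U` (coefficients of all negative powers of `z`; those of
the nonnegative powers agree by the definition of `U`). -/
def FormalODE {m : ℕ} (x α : Fin m → ℂ) (μ : ℕ → ℂ) : Prop :=
  ∀ j, negCoeff (derivCoeff μ) (W x) j = negCoeff μ (2 * V x α) j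

/-- `Θₙ = W (q' p - p' q) - 2 V q p - U p²`, where `p = pₙ` and `q = pₙ₋₁⁽¹⁾` is the associated
polynomial, that is, the polynomial part of `f pₙ`. -/
noncomputable def Theta {m : ℕ} (x α : Fin m → ℂ) (μ : ℕ → ℂ) (p : ℕ → ℂ[X]) (n : ℕ) : ℂ[X] :=
  W x * (derivative (polyPart μ (p n)) * p n - derivative (p n) * polyPart μ (p n))
    - 2 * V x α * polyPart μ (p n) * p n - U x α μ * p n ^ 2

/-- `Ω₀ = V` and, for `n ≥ 1`,
`Ωₙ = aₙ W (q' pₙ₋₁ - pₙ' r) - aₙ V (q pₙ₋₁ + pₙ r) - aₙ U pₙ pₙ₋₁`, where `q = pₙ₋₁⁽¹⁾` and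
`r = pₙ₋₂⁽¹⁾` are the polynomial parts of `f pₙ` and `f pₙ₋₁`. -/
noncomputable def Omega {m : ℕ} (x α : Fin m → ℂ) (μ : ℕ → ℂ) (a : ℕ → ℂ) (p : ℕ → ℂ[X]) :
    ℕ → ℂ[X]
  | 0 => V x α
  | n + 1 => C (a (n + 1)) *
      (W x * (derivative (polyPart μ (p (n + 1))) * p n
          - derivative (p (n + 1)) * polyPart μ (p n))
        - V x α * (polyPart μ (p (n + 1)) * p n + p (n + 1) * polyPart μ (p n))
        - U x α μ * (p (n + 1) * p n))

/-! ### Orthonormal polynomials and recurrence coefficients -/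

/-- `p n` has degree `n`, and the `p n` are orthonormal for the (bilinear) form with moments `μ`. -/
structure IsOrthonormal (μ : ℕ → ℂ) (p : ℕ → ℂ[X]) : Prop where
  natDegree_eq : ∀ n, (p n).natDegree = n
  orthonormal : ∀ n k, linForm μ (p n * p k) = if n = k then 1 else 0

/-- `aₙ₊₁ pₙ₊₁ = (z - bₙ) pₙ - aₙ pₙ₋₁` for `n ≥ 0`, with `p₋₁ = 0` (so `a 0` plays no role). -/
structure IsRecurrence (p : ℕ → ℂ[X]) (a b : ℕ → ℂ) : Prop where
  zero : C (a 1) * p 1 = (X - C (b 0)) * p 0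
  succ : ∀ n, C (a (n + 2)) * p (n + 2)
    = (X - C (b (n + 1))) * p (n + 1) - C (a (n + 1)) * p n

/-! ### Arcs depending on a parameter, and the weight on them -/

/-- A family of parametrized curves `s ↦ γ t s`, `0 ≤ s ≤ 1`, which is continuously differentiable
in `s` and such that `γ` and its velocity `∂γ/∂s` depend in a `C¹` way on the parameter `t ∈ T`. -/
structure IsCurveFamily {𝕜 : Type*} [RCLike 𝕜] [NormedAlgebra 𝕜 ℂ] (T : Set 𝕜)
    (γ : 𝕜 → ℝ → ℂ) : Prop where
  diff_s : ∀ t ∈ T, ∀ s ∈ Set.Icc (0 : ℝ) 1, DifferentiableAt ℝ (γ t) s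
  diff_t : ∀ t ∈ T, ∀ s ∈ Set.Icc (0 : ℝ) 1, DifferentiableAt 𝕜 (fun τ => γ τ s) t
  diff_ts : ∀ t ∈ T, ∀ s ∈ Set.Icc (0 : ℝ) 1, DifferentiableAt 𝕜 (fun τ => deriv (γ τ) s) t
  cont : ContinuousOn (fun q : 𝕜 × ℝ => γ q.1 q.2) (T ×ˢ Set.Icc (0 : ℝ) 1)
  cont_s : ContinuousOn (fun q : 𝕜 × ℝ => deriv (γ q.1) q.2) (T ×ˢ Set.Icc (0 : ℝ) 1)
  cont_t : ContinuousOn (fun q : 𝕜 × ℝ => deriv (fun τ => γ τ q.2) q.1)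
    (T ×ˢ Set.Icc (0 : ℝ) 1)
  cont_ts : ContinuousOn (fun q : 𝕜 × ℝ => deriv (fun τ => deriv (γ τ) q.2) q.1)
    (T ×ˢ Set.Icc (0 : ℝ) 1)

/-- `ℓ k` is a branch of `log (z - xₖ(t))` along the curves, for the curve parameters `s ∈ I`,
continuous in `(t, s)`.  In particular the curve avoids all `xₖ(t)` for `s ∈ I`. -/
structure IsLogBranch {𝕜 : Type*} [RCLike 𝕜] (T : Set 𝕜) (I : Set ℝ) {m : ℕ}
    (x : Fin m → 𝕜 → ℂ) (γ : 𝕜 → ℝ → ℂ) (ℓ : Fin m → 𝕜 → ℝ → ℂ) : Prop where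
  cont : ∀ k, ContinuousOn (fun q : 𝕜 × ℝ => ℓ k q.1 q.2) (T ×ˢ I)
  exp_eq : ∀ k, ∀ t ∈ T, ∀ s ∈ I, Complex.exp (ℓ k t s) = γ t s - x k t

/-- The value `∏ₖ (z - xₖ)^αₖ` at the point of the curve with parameter `s`, for the branches of
the logarithms given by `ℓ`. -/
noncomputable def branch {𝕜 : Type*} {m : ℕ} (α : Fin m → ℂ) (ℓ : Fin m → 𝕜 → ℝ → ℂ)
    (t : 𝕜) (s : ℝ) : ℂ :=
  ∏ k, Complex.exp (α k * ℓ k t s)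

/-- The curves `γ t` are arcs joining `xᵢ(t)` to `xⱼ(t)` (for fixed `i`, `j`, possibly equal), which
avoid all the `xₖ(t)` in between, have nonzero tangents at both ends, and carry a weight that is
integrable at the ends: `Re αᵢ > -1` and `Re αⱼ > -1`. -/
structure IsJoiningArc {𝕜 : Type*} [RCLike 𝕜] [NormedAlgebra 𝕜 ℂ] (T : Set 𝕜) {m : ℕ}
    (x : Fin m → 𝕜 → ℂ) (α : Fin m → ℂ) (γ : 𝕜 → ℝ → ℂ) (ℓ : Fin m → 𝕜 → ℝ → ℂ) : Prop where
  family : IsCurveFamily T γ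
  log : IsLogBranch T (Set.Ioo 0 1) x γ ℓ
  source : ∃ i, -1 < (α i).re ∧ ∀ t ∈ T, γ t 0 = x i t
  target : ∃ j, -1 < (α j).re ∧ ∀ t ∈ T, γ t 1 = x j t
  tangent_source : ∀ t ∈ T, deriv (γ t) 0 ≠ 0
  tangent_target : ∀ t ∈ T, deriv (γ t) 1 ≠ 0

/-- The curves `γ t` are closed contours avoiding all the `xₖ(t)`, along which the weight returns to
its initial value.  (For instance double loops around two points `xᵢ`, `xⱼ`, which replace the arc
from `xᵢ` to `xⱼ` when the weight is not integrable there.) -/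
structure IsClosedContour {𝕜 : Type*} [RCLike 𝕜] [NormedAlgebra 𝕜 ℂ] (T : Set 𝕜) {m : ℕ}
    (x : Fin m → 𝕜 → ℂ) (α : Fin m → ℂ) (γ : 𝕜 → ℝ → ℂ) (ℓ : Fin m → 𝕜 → ℝ → ℂ) : Prop where
  family : IsCurveFamily T γ
  log : IsLogBranch T (Set.Icc 0 1) x γ ℓ
  closed : ∀ t ∈ T, γ t 0 = γ t 1
  branch_closed : ∀ t ∈ T, branch α ℓ t 0 = branch α ℓ t 1

/-- The moments `μₙ(t) = ∑ⱼ Aⱼ ∫_{Sⱼ(t)} zⁿ ∏ₖ (z - xₖ(t))^αₖ dz` of the generalized Jacobi weight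
on the curves `Sⱼ(t)` parametrized by `γ j t`. -/
noncomputable def moment {𝕜 : Type*} {m r : ℕ} (α : Fin m → ℂ) (A : Fin r → ℂ)
    (γ : Fin r → 𝕜 → ℝ → ℂ) (ℓ : Fin r → Fin m → 𝕜 → ℝ → ℂ) (t : 𝕜) (n : ℕ) : ℂ :=
  ∑ j, A j * ∫ s in (0 : ℝ)..1, γ j t s ^ n * branch α (ℓ j) t s * deriv (γ j t) s

end Toda

namespace Toda

/-! ### The linear form of a moment sequence -/

/-! Everything follows from two identities for the form `L` with the moments `μ`. Integrating total
derivatives along the curves, whose boundary terms vanish or cancel, gives the Pearson relation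
`L((φW)' + 2Vφ) = 0` (`isPearson_moment`); on monomials this is the differential equation for `f`.

For the dependence on `t`, let `D` be the Lagrange interpolation polynomial with `D(x_k) = ẋ_k`.
Moving the plane along the vector field `D` carries the points `x_k` along to first order, and
changes the weight by the factor `E = ∑ α_k (D - ẋ_k)/(z - x_k)`, which is a polynomial. Hence
`L̇(φ) = L((φD)' + φE)`. Expanding `D` in Lagrange's basis and reducing each term with the Pearson
relation (`IsPearson.linMap_shift`) gives `L̇(φ) = ∑ (-Uφ - 2Vφ⁽¹⁾)(x_k) ẋ_k / W'(x_k)`, where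
`φ⁽¹⁾` is the polynomial part of `fφ` (`exists_hasDerivAt_moment`). As `W(x_k) = 0`, the bracket is
`Θ_n(x_k)` for `φ = p_n²` and `(Ω_{n+1} - V)(x_k)/a_{n+1}` for `φ = p_{n+1} p_n`.

For any differentiable moments, orthogonality alone gives `ȧ_{n+1}/a_{n+1} = (L̇(p_{n+1}²) -
L̇(p_n²))/2` and `ḃ_0 + … + ḃ_n = a_{n+1} L̇(p_{n+1} p_n)` (`hasDerivAt_recurrence_a`,
`hasDerivAt_recurrence_b`). Differentiability of the coefficients is obtained along the monic
recurrence.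

The analytic difficulty is differentiation under the integral with a singular weight at moving ends.
An end attached to `x_k` moves with it, so `(∂γ/∂t - ẋ_k)/(γ - x_k)` stays bounded
(`IsAdmissible.exists_norm_deriv_sub_le`), and the differentiated integrand is no more singular than
the weight. -/

theorem linForm_add (μ : ℕ → ℂ) (P Q : ℂ[X]) :
    linForm μ (P + Q) = linForm μ P + linForm μ Q :=
  sum_add_index P Q _ (by simp) (by intros; ring)

theorem linForm_C_mul (μ : ℕ → ℂ) (c : ℂ) (P : ℂ[X]) :
    linForm μ (C c * P) = c * linForm μ P := by
  unfold linForm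
  rw [← smul_eq_C_mul, sum_smul_index _ _ _ (by simp), sum_def, sum_def, Finset.mul_sum]
  exact Finset.sum_congr rfl fun i _ => by ring

/-- `linForm` as a linear map. -/
noncomputable def linMap (μ : ℕ → ℂ) : ℂ[X] →ₗ[ℂ] ℂ where
  toFun := linForm μ
  map_add' := linForm_add μ
  map_smul' c P := by simp [smul_eq_C_mul, linForm_C_mul]

theorem linMap_apply (μ : ℕ → ℂ) (P : ℂ[X]) : linMap μ P = linForm μ P := rfl

theorem linMap_C_mul (μ : ℕ → ℂ) (c : ℂ) (P : ℂ[X]) :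
    linMap μ (C c * P) = c * linMap μ P := linForm_C_mul μ c P

theorem linMap_monomial (μ : ℕ → ℂ) (n : ℕ) (c : ℂ) :
    linMap μ (monomial n c) = c * μ n := by
  simp [linMap_apply, linForm, sum_monomial_index]

theorem linForm_eq_sum_range (μ : ℕ → ℂ) {P : ℂ[X]} {N : ℕ} (h : P.natDegree < N) :
    linForm μ P = ∑ i ∈ Finset.range N, P.coeff i * μ i :=
  sum_over_range' P (by simp) N h

/-- The coefficient of `z^(-n-1)` in `f'` is `-n μ_{n-1}`, minus the value of the form at the
derivative of `z^n`. -/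
theorem linMap_derivCoeff (μ : ℕ → ℂ) (P : ℂ[X]) :
    linMap (derivCoeff μ) P = -linMap μ (derivative P) := by
  induction P using Polynomial.induction_on' with
  | add p q hp hq => simp only [map_add, hp, hq]; ring
  | monomial n c =>
    rw [derivative_monomial, linMap_monomial, linMap_monomial]
    cases n with
    | zero => simp [derivCoeff]
    | succ n => simp [derivCoeff]; ring

theorem negCoeff_eq_linMap (c : ℕ → ℂ) (P : ℂ[X]) (j : ℕ) :
    negCoeff c P j = linMap c (X ^ j * P) := by
  induction P using Polynomial.induction_on' with
  | add p q hp hq =>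
    rw [mul_add, map_add, ← hp, ← hq]
    exact sum_add_index p q _ (by simp) (by intros; ring)
  | monomial n a =>
    rw [X_pow_mul_monomial, linMap_monomial]
    simp [negCoeff, sum_monomial_index]

/-! ### Divided differences -/

/-- The divided difference `(P(z) - P(x)) / (z - x)`. -/
noncomputable def dd (x : ℂ) (P : ℂ[X]) : ℂ[X] := P /ₘ (X - C x)

theorem X_sub_C_mul_dd (x : ℂ) (P : ℂ[X]) : (X - C x) * dd x P = P - C (P.eval x) := by
  rw [dd, X_sub_C_mul_divByMonic_eq_sub_modByMonic, modByMonic_X_sub_C_eq_C_eval]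

theorem eq_dd {x : ℂ} {P Q : ℂ[X]} {c : ℂ} (h : (X - C x) * Q = P - C c) : dd x P = Q := by
  have h1 : c = P.eval x := by
    have := congrArg (eval x) h
    simp only [eval_mul, eval_sub, eval_X, eval_C, sub_self, zero_mul] at this
    linear_combination this
  apply mul_left_cancel₀ (X_sub_C_ne_zero x)
  rw [X_sub_C_mul_dd, h, h1]

theorem dd_add (x : ℂ) (P Q : ℂ[X]) : dd x (P + Q) = dd x P + dd x Q := by
  apply eq_dd (c := P.eval x + Q.eval x)
  rw [mul_add, X_sub_C_mul_dd, X_sub_C_mul_dd, map_add]; ring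

theorem dd_mul (x : ℂ) (P Q : ℂ[X]) : dd x (P * Q) = P * dd x Q + C (Q.eval x) * dd x P := by
  apply eq_dd (c := P.eval x * Q.eval x)
  rw [map_mul]
  linear_combination P * X_sub_C_mul_dd x Q + C (Q.eval x) * X_sub_C_mul_dd x P

theorem natDegree_dd (x : ℂ) (P : ℂ[X]) : (dd x P).natDegree = P.natDegree - 1 := by
  rw [dd, natDegree_divByMonic _ (monic_X_sub_C x), natDegree_X_sub_C]

theorem leadingCoeff_dd {x : ℂ} {P : ℂ[X]} (h : 0 < P.natDegree) :
    (dd x P).leadingCoeff = P.leadingCoeff :=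
  leadingCoeff_divByMonic_of_monic (monic_X_sub_C x) (by
    rw [degree_X_sub_C]; exact Nat.WithBot.one_le_iff_zero_lt.2 (natDegree_pos_iff_degree_pos.1 h))

/-- This is the classical formula for associated polynomials; on monomials it is the geometric sum.
It turns every question about polynomial parts into one about divided differences, where
orthogonality applies. -/
theorem eval_polyPart (c : ℕ → ℂ) (P : ℂ[X]) (x : ℂ) :
    (polyPart c P).eval x = linMap c (dd x P) := by
  induction P using Polynomial.induction_on' with
  | add p q hp hq =>
    rw [dd_add, map_add, ← hp, ← hq, ← eval_add]
    congr 1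
    exact sum_add_index p q _ (by simp) (by
      intros; rw [← Finset.sum_add_distrib]; refine Finset.sum_congr rfl fun i _ => ?_
      rw [add_mul, map_add, add_mul])
  | monomial n a =>
    have h : dd x (monomial n a)
        = ∑ k ∈ Finset.range n, C (a * x ^ (n - 1 - k)) * X ^ k := by
      apply eq_dd (c := a * x ^ n)
      rw [← C_mul_X_pow_eq_monomial, map_mul, map_pow, ← mul_sub,
        ← (Commute.all (X : ℂ[X]) (C x)).mul_geom_sum₂, Finset.mul_sum, Finset.mul_sum,
        Finset.mul_sum]
      refine Finset.sum_congr rfl fun i _ => ?_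
      rw [map_mul, map_pow]; ring
    rw [h, map_sum]
    simp only [polyPart, sum_monomial_index, zero_mul, map_zero, Finset.sum_const_zero,
      eval_finsetSum, eval_mul, eval_C, eval_pow, eval_X, linMap_C_mul]
    refine Finset.sum_congr rfl fun i _ => ?_
    rw [← monomial_one_right_eq_X_pow, linMap_monomial]; ring

/-! ### The weight polynomials -/

section Weight

variable {m : ℕ} (x α : Fin m → ℂ)

/-- `W(z) / (z - xₖ)`. -/
noncomputable def cofactor (k : Fin m) : ℂ[X] := ∏ l ∈ Finset.univ.erase k, (X - C (x l))

theorem X_sub_C_mul_cofactor (k : Fin m) : (X - C (x k)) * cofactor x k = W x :=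
  Finset.mul_prod_erase Finset.univ (fun l => X - C (x l)) (Finset.mem_univ k)

theorem eval_W (k : Fin m) : (W x).eval (x k) = 0 := by
  rw [← X_sub_C_mul_cofactor x k]; simp

theorem eval_cofactor_of_ne {k l : Fin m} (h : l ≠ k) : (cofactor x k).eval (x l) = 0 := by
  rw [cofactor, eval_prod]
  exact Finset.prod_eq_zero (Finset.mem_erase.2 ⟨h, Finset.mem_univ l⟩) (by simp)

theorem eval_derivative_W (k : Fin m) :
    (derivative (W x)).eval (x k) = (cofactor x k).eval (x k) := by
  rw [← X_sub_C_mul_cofactor x k, derivative_mul]; simp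

variable {x} in
theorem eval_cofactor_ne_zero (hx : Function.Injective x) (k : Fin m) :
    (cofactor x k).eval (x k) ≠ 0 := by
  rw [cofactor, eval_prod]
  refine Finset.prod_ne_zero_iff.2 fun l hl => ?_
  simp only [eval_sub, eval_X, eval_C]
  exact sub_ne_zero.2 fun h => (Finset.mem_erase.1 hl).1 (hx h).symm

theorem two_mul_V : 2 * V x α = ∑ k, C (α k) * cofactor x k := by
  have : (2 : ℂ[X]) * C (1 / 2) = 1 := by
    rw [show (2 : ℂ[X]) = C 2 from (map_ofNat C 2).symm, ← C_mul]; simp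
  rw [V, ← mul_assoc, this, one_mul]; rfl

theorem eval_two_mul_V (k : Fin m) :
    (2 * V x α).eval (x k) = α k * (cofactor x k).eval (x k) := by
  rw [two_mul_V, eval_finsetSum, Finset.sum_eq_single k]
  · simp
  · intro l _ h
    rw [eval_mul, eval_cofactor_of_ne x h.symm, mul_zero]
  · simp

/-- The linear form annihilates the total derivatives `(φ W)' + 2 V φ`. -/
def IsPearson (μ : ℕ → ℂ) : Prop :=
  ∀ φ, linMap μ (derivative (φ * W x) + 2 * V x α * φ) = 0

variable {x α} {μ : ℕ → ℂ}

/-- The coefficient of `z^(-j-1)` in `W f' - 2 V f` is minus the Pearson functional at `φ = z^j`. -/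
theorem IsPearson.formalODE (h : IsPearson x α μ) : FormalODE x α μ := by
  intro j
  rw [negCoeff_eq_linMap, negCoeff_eq_linMap, linMap_derivCoeff]
  have := h (X ^ j)
  rw [map_add, mul_comm (2 * V x α)] at this
  linear_combination -this

variable (x α μ) in
theorem eval_U (k : Fin m) :
    (U x α μ).eval (x k)
      = -linMap μ (derivative (cofactor x k)) - linMap μ (dd (x k) (2 * V x α)) := by
  rw [U, eval_sub, eval_polyPart, eval_polyPart, linMap_derivCoeff,
    eq_dd (P := W x) (Q := cofactor x k) (c := 0) (by rw [X_sub_C_mul_cofactor]; simp)]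

/-- The value at `xₖ` of `-U φ - 2 V φ⁽¹⁾`, where `φ⁽¹⁾` is the polynomial part of `f φ`. -/
theorem IsPearson.linMap_shift (h : IsPearson x α μ) (φ : ℂ[X]) (k : Fin m) :
    linMap μ (derivative (φ * cofactor x k) + φ * dd (x k) (2 * V x α))
      = -((U x α μ).eval (x k) * φ.eval (x k))
        - (2 * V x α).eval (x k) * (polyPart μ φ).eval (x k) := by
  -- Split `φ = (z - x_k) ψ + φ(x_k)` with `ψ = dd (x k) φ`. The factor `z - x_k` completes the
  -- cofactor to `W` and `dd (x k) (2V)` to `2V - 2V(x_k)`, so `ψ` contributes a Pearson term and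
  -- the correction `-2V(x_k) ψ`.
  have e : derivative (φ * cofactor x k) + φ * dd (x k) (2 * V x α)
      = C (φ.eval (x k)) * (derivative (cofactor x k) + dd (x k) (2 * V x α))
        + (derivative (dd (x k) φ * W x) + 2 * V x α * dd (x k) φ)
        - C ((2 * V x α).eval (x k)) * dd (x k) φ := by
    have h1 := X_sub_C_mul_dd (x k) φ
    have h2 := X_sub_C_mul_dd (x k) (2 * V x α)
    have h3 : φ = (X - C (x k)) * dd (x k) φ + C (φ.eval (x k)) := by rw [h1]; ring
    have h4 : φ * cofactor x k = dd (x k) φ * W x + C (φ.eval (x k)) * cofactor x k := by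
      rw [← X_sub_C_mul_cofactor x k]; nth_rewrite 1 [h3]; ring
    rw [h4, derivative_add, derivative_C_mul]
    linear_combination dd (x k) (2 * V x α) * (-h1) + dd (x k) φ * h2
  rw [e, map_sub, map_add, h, linMap_C_mul, linMap_C_mul, map_add, eval_U, eval_polyPart]
  ring

end Weight

/-! ### Orthonormal polynomials -/

section Orthonormal

variable {μ : ℕ → ℂ} {p : ℕ → ℂ[X]} {a b : ℕ → ℂ}

theorem IsOrthonormal.leadingCoeff_ne_zero (h : IsOrthonormal μ p) (n : ℕ) :
    (p n).leadingCoeff ≠ 0 := by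
  rw [Ne, leadingCoeff_eq_zero]
  intro h0
  have := h.orthonormal n n
  rw [h0] at this
  simp [linForm] at this

/-- Induction on the degree bound: subtracting a multiple of `p N` from `Q` lowers the degree, and
`p N` is orthogonal to `p n` because `N < n`. -/
theorem IsOrthonormal.linMap_mul_eq_zero (h : IsOrthonormal μ p) {n : ℕ} :
    ∀ {N : ℕ}, N ≤ n → ∀ {Q : ℂ[X]}, Q.degree < N → linMap μ (p n * Q) = 0 := by
  intro N
  induction N with
  | zero =>
    intro _ Q hQ
    have : Q = 0 := by
      rw [← degree_eq_bot]; simpa [Nat.cast_withBot] using hQ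
    simp [this]
  | succ N ih =>
    intro hN Q hQ
    have hl := h.leadingCoeff_ne_zero N
    have key : (Q - C (Q.coeff N / (p N).leadingCoeff) * p N).degree < N := by
      rw [degree_lt_iff_coeff_zero]
      intro i hi
      rw [coeff_sub, coeff_C_mul]
      rcases hi.eq_or_lt with rfl | hi
      · have : (p N).coeff N = (p N).leadingCoeff := by rw [leadingCoeff, h.natDegree_eq]
        rw [this]; field_simp; ring
      · rw [coeff_eq_zero_of_degree_lt (n := i) (hQ.trans_le (by exact_mod_cast hi)),
          coeff_eq_zero_of_natDegree_lt (p := p N) (by rw [h.natDegree_eq]; exact hi)]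
        ring
    have e : p n * Q = p n * (Q - C (Q.coeff N / (p N).leadingCoeff) * p N)
        + C (Q.coeff N / (p N).leadingCoeff) * (p n * p N) := by ring
    rw [e, map_add, ih (by omega) key, linMap_C_mul, linMap_apply, h.orthonormal,
      if_neg (by omega)]
    ring

theorem IsOrthonormal.linMap_mul (h : IsOrthonormal μ p) {n : ℕ} {Q : ℂ[X]}
    (hQ : Q.natDegree ≤ n) : linMap μ (p n * Q) = Q.coeff n / (p n).leadingCoeff := by
  have hl := h.leadingCoeff_ne_zero n
  have key : (Q - C (Q.coeff n / (p n).leadingCoeff) * p n).degree < n := by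
    rw [degree_lt_iff_coeff_zero]
    intro i hi
    rw [coeff_sub, coeff_C_mul]
    rcases hi.eq_or_lt with rfl | hi
    · have : (p n).coeff n = (p n).leadingCoeff := by rw [leadingCoeff, h.natDegree_eq]
      rw [this]; field_simp; ring
    · rw [coeff_eq_zero_of_natDegree_lt (hQ.trans_lt hi),
        coeff_eq_zero_of_natDegree_lt (p := p n) (by rw [h.natDegree_eq]; exact hi)]
      ring
  have e : p n * Q = p n * (Q - C (Q.coeff n / (p n).leadingCoeff) * p n)
      + C (Q.coeff n / (p n).leadingCoeff) * (p n * p n) := by ring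
  rw [e, map_add, h.linMap_mul_eq_zero le_rfl key, linMap_C_mul, linMap_apply, h.orthonormal,
    if_pos rfl]
  ring

/-- Comparison of the coefficients of `z^(n+1)` in the recurrence, whose last term has too small a
degree to contribute. -/
theorem IsRecurrence.leadingCoeff_eq (h : IsOrthonormal μ p) (hr : IsRecurrence p a b) (n : ℕ) :
    a (n + 1) * (p (n + 1)).leadingCoeff = (p n).leadingCoeff := by
  have hc : ∀ k, (p k).coeff k = (p k).leadingCoeff := fun k => by
    rw [leadingCoeff, h.natDegree_eq]
  cases n with
  | zero =>
    have := congrArg (fun P => coeff P 1) hr.zero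
    simp only [coeff_C_mul, sub_mul, coeff_sub, coeff_X_mul] at this
    rw [← hc 0, ← hc 1, zero_add, this,
      coeff_eq_zero_of_natDegree_lt (p := p 0) (n := 1) (by rw [h.natDegree_eq]; omega)]
    ring
  | succ n =>
    have := congrArg (fun P => coeff P (n + 2)) (hr.succ n)
    simp only [coeff_C_mul, sub_mul, coeff_sub, coeff_X_mul] at this
    rw [← hc, ← hc, this,
      coeff_eq_zero_of_natDegree_lt (p := p (n + 1)) (n := n + 2) (by rw [h.natDegree_eq]; omega),
      coeff_eq_zero_of_natDegree_lt (p := p n) (n := n + 2) (by rw [h.natDegree_eq]; omega)]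
    ring

theorem IsRecurrence.ne_zero (h : IsOrthonormal μ p) (hr : IsRecurrence p a b) (n : ℕ) :
    a (n + 1) ≠ 0 := fun h0 => by
  have := hr.leadingCoeff_eq h n
  rw [h0, zero_mul] at this
  exact h.leadingCoeff_ne_zero n this.symm

theorem IsOrthonormal.linMap_mul_dd_self (h : IsOrthonormal μ p) (n : ℕ) (z : ℂ) :
    linMap μ (p n * dd z (p n)) = 0 := by
  rcases Nat.eq_zero_or_pos n with rfl | hn
  · have : dd z (p 0) = 0 := by
      have h0 := natDegree_eq_zero.1 (h.natDegree_eq 0)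
      obtain ⟨c, hc⟩ := h0
      exact eq_dd (c := c) (by rw [hc]; simp)
    simp [this]
  · refine h.linMap_mul_eq_zero le_rfl (degree_le_natDegree.trans_lt ?_)
    rw [natDegree_dd, h.natDegree_eq]
    exact_mod_cast Nat.sub_lt hn one_pos

/-- In the product rule for divided differences the term `p n * dd z (p n)` is killed by the form,
since `dd z (p n)` has lower degree. -/
theorem IsOrthonormal.eval_polyPart_sq (h : IsOrthonormal μ p) (n : ℕ) (z : ℂ) :
    (polyPart μ (p n ^ 2)).eval z = (p n).eval z * (polyPart μ (p n)).eval z := by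
  rw [eval_polyPart, eval_polyPart, pow_two, dd_mul, map_add, linMap_C_mul,
    h.linMap_mul_dd_self, zero_add]

theorem IsOrthonormal.eval_polyPart_mul_succ (h : IsOrthonormal μ p) (n : ℕ) (z : ℂ) :
    (polyPart μ (p (n + 1) * p n)).eval z
      = (p n).eval z * (polyPart μ (p (n + 1))).eval z := by
  rw [eval_polyPart, eval_polyPart, dd_mul, map_add, linMap_C_mul,
    h.linMap_mul_eq_zero (N := n + 1) le_rfl, zero_add]
  refine degree_le_natDegree.trans_lt ?_
  rw [natDegree_dd, h.natDegree_eq]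
  exact_mod_cast (by omega)

/-- Here the product rule is applied with the factors in the other order. Now `dd z (p (n + 1))` has
degree exactly `n`, so the form does not kill its product with `p n` but gives a ratio of leading
coefficients, `1/a_{n+1}`. Comparison with `eval_polyPart_mul_succ` is the Casorati relation. -/
theorem IsOrthonormal.eval_polyPart_mul_succ' (h : IsOrthonormal μ p) (hr : IsRecurrence p a b)
    (n : ℕ) (z : ℂ) :
    a (n + 1) * (polyPart μ (p (n + 1) * p n)).eval z
      = a (n + 1) * ((p (n + 1)).eval z * (polyPart μ (p n)).eval z) + 1 := by
  have e : linMap μ (p n * dd z (p (n + 1))) = (p (n + 1)).leadingCoeff / (p n).leadingCoeff := by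
    have hd : (dd z (p (n + 1))).natDegree = n := by
      rw [natDegree_dd, h.natDegree_eq]; rfl
    rw [h.linMap_mul hd.le]
    congr 1
    rw [← leadingCoeff_dd (x := z) (by rw [h.natDegree_eq]; omega), leadingCoeff, hd]
  have hl := h.leadingCoeff_ne_zero n
  rw [eval_polyPart, eval_polyPart, mul_comm (p (n + 1)), dd_mul, map_add, linMap_C_mul, e]
  have := hr.leadingCoeff_eq h n
  field_simp
  linear_combination this

variable {m : ℕ} (x α : Fin m → ℂ)

theorem IsOrthonormal.eval_Theta (h : IsOrthonormal μ p) (n : ℕ) (k : Fin m) :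
    (Theta x α μ p n).eval (x k) = -((U x α μ).eval (x k) * (p n ^ 2).eval (x k))
        - (2 * V x α).eval (x k) * (polyPart μ (p n ^ 2)).eval (x k) := by
  rw [h.eval_polyPart_sq, Theta]
  simp only [eval_sub, eval_mul, eval_W, eval_pow]
  ring

/-- At a zero of `W` only the `V` and `U` terms remain. The two products multiplying `V` both equal
the polynomial part of `f p_{n+1} p_n`, except for the extra `1/a_{n+1}` in one of them; that defect
produces one `V`, which `Ω_0 = V` cancels. -/
theorem IsOrthonormal.eval_Omega_succ (h : IsOrthonormal μ p) (hr : IsRecurrence p a b)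
    (n : ℕ) (k : Fin m) :
    (Omega x α μ a p (n + 1)).eval (x k) - (Omega x α μ a p 0).eval (x k)
      = a (n + 1) * (-((U x α μ).eval (x k) * (p (n + 1) * p n).eval (x k))
        - (2 * V x α).eval (x k) * (polyPart μ (p (n + 1) * p n)).eval (x k)) := by
  have h1 := h.eval_polyPart_mul_succ n (x k)
  have h2 := h.eval_polyPart_mul_succ' hr n (x k)
  rw [h1] at h2
  rw [h1, Omega, Omega]
  simp only [eval_sub, eval_mul, eval_W, eval_add, eval_C, eval_ofNat]
  linear_combination (V x α).eval (x k) * h2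

end Orthonormal

/-! ### Polynomials depending on a parameter -/

section PolyDeriv

variable {𝕜 : Type*} [RCLike 𝕜] [NormedAlgebra 𝕜 ℂ]

/-- The polynomials `P τ` have bounded degree, and their coefficients are differentiable at `t`,
with the coefficients of `P'` as derivatives. -/
def HasPolyDerivAt (P : 𝕜 → ℂ[X]) (P' : ℂ[X]) (t : 𝕜) : Prop :=
  (∃ N, ∀ τ, (P τ).natDegree ≤ N) ∧ ∀ i, HasDerivAt (fun τ => (P τ).coeff i) (P'.coeff i) t

variable {P Q : 𝕜 → ℂ[X]} {P' Q' : ℂ[X]} {t : 𝕜}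

theorem HasPolyDerivAt.const (R : ℂ[X]) : HasPolyDerivAt (fun _ : 𝕜 => R) 0 t :=
  ⟨⟨R.natDegree, fun _ => le_rfl⟩, fun i => by simpa using hasDerivAt_const t (R.coeff i)⟩

theorem hasPolyDerivAt_C {c : 𝕜 → ℂ} {c' : ℂ} (h : HasDerivAt c c' t) :
    HasPolyDerivAt (fun τ => Polynomial.C (c τ)) (Polynomial.C c') t :=
  ⟨⟨0, fun _ => (natDegree_C _).le⟩, fun i => by
    simp only [coeff_C]
    split_ifs
    · exact h
    · exact hasDerivAt_const t 0⟩

theorem HasPolyDerivAt.sub (hP : HasPolyDerivAt P P' t) (hQ : HasPolyDerivAt Q Q' t) :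
    HasPolyDerivAt (fun τ => P τ - Q τ) (P' - Q') t := by
  obtain ⟨⟨N, hN⟩, hP⟩ := hP
  obtain ⟨⟨M, hM⟩, hQ⟩ := hQ
  refine ⟨⟨max N M, fun τ => (natDegree_sub_le _ _).trans (max_le_max (hN τ) (hM τ))⟩, fun i => ?_⟩
  simp only [coeff_sub]
  exact (hP i).sub (hQ i)

theorem HasPolyDerivAt.mul (hP : HasPolyDerivAt P P' t) (hQ : HasPolyDerivAt Q Q' t) :
    HasPolyDerivAt (fun τ => P τ * Q τ) (P' * Q t + P t * Q') t := by
  obtain ⟨⟨N, hN⟩, hP⟩ := hP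
  obtain ⟨⟨M, hM⟩, hQ⟩ := hQ
  refine ⟨⟨N + M, fun τ => natDegree_mul_le.trans (add_le_add (hN τ) (hM τ))⟩, fun i => ?_⟩
  simp only [coeff_add, coeff_mul, ← Finset.sum_add_distrib]
  exact HasDerivAt.fun_sum fun j _ => (hP j.1).mul (hQ j.2)

theorem HasPolyDerivAt.natDegree_le (hP : HasPolyDerivAt P P' t) {N : ℕ}
    (hN : ∀ τ, (P τ).natDegree ≤ N) : P'.natDegree ≤ N := by
  rw [natDegree_le_iff_coeff_eq_zero]
  intro i hi
  have h := hP.2 i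
  have e : (fun τ => (P τ).coeff i) = fun _ => 0 :=
    funext fun τ => coeff_eq_zero_of_natDegree_lt ((hN τ).trans_lt hi)
  rw [e] at h
  exact h.unique (hasDerivAt_const t 0)

/-- The degree bound, uniform in the parameter, makes the form a finite sum over a fixed range, to
which the product rule applies. -/
theorem HasPolyDerivAt.hasDerivAt_linMap (hP : HasPolyDerivAt P P' t) {μ : 𝕜 → ℕ → ℂ} {μ' : ℕ → ℂ}
    (hμ : ∀ n, HasDerivAt (fun τ => μ τ n) (μ' n) t) :
    HasDerivAt (fun τ => linMap (μ τ) (P τ)) (linMap μ' (P t) + linMap (μ t) P') t := by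
  obtain ⟨N, hN⟩ := hP.1
  have h' := hP.natDegree_le hN
  have e : (fun τ => linMap (μ τ) (P τ))
      = fun τ => ∑ i ∈ Finset.range (N + 1), (P τ).coeff i * μ τ i :=
    funext fun τ => linForm_eq_sum_range _ (Nat.lt_succ_of_le (hN τ))
  rw [e, linMap_apply, linMap_apply, linForm_eq_sum_range _ (Nat.lt_succ_of_le (hN t)),
    linForm_eq_sum_range _ (Nat.lt_succ_of_le h'), ← Finset.sum_add_distrib]
  refine HasDerivAt.fun_sum fun i _ => ?_
  exact ((hP.2 i).fun_mul (hμ i)).congr_deriv (add_comm _ _)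

end PolyDeriv

/-! ### Monic orthogonal polynomials -/

section Monic

/-- The monic polynomials with recurrence coefficients `b n`, `c n`. -/
noncomputable def monicRec (b c : ℕ → ℂ) : ℕ → ℂ[X]
  | 0 => 1
  | 1 => X - C (b 0)
  | n + 2 => (X - C (b (n + 1))) * monicRec b c (n + 1) - C (c n) * monicRec b c n

theorem monicRec_degree (b c : ℕ → ℂ) (n : ℕ) :
    (monicRec b c n).natDegree ≤ n ∧ (monicRec b c n).coeff n = 1 := by
  suffices h : ((monicRec b c n).natDegree ≤ n ∧ (monicRec b c n).coeff n = 1) ∧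
      ((monicRec b c (n + 1)).natDegree ≤ n + 1 ∧ (monicRec b c (n + 1)).coeff (n + 1) = 1) from h.1
  induction n with
  | zero => simp [monicRec]
  | succ n ih =>
    refine ⟨ih.2, ?_, ?_⟩
    · rw [monicRec]
      refine (natDegree_sub_le _ _).trans (max_le ?_ ?_)
      · refine natDegree_mul_le.trans ?_
        rw [natDegree_X_sub_C]; linarith [ih.2.1]
      · exact (natDegree_C_mul_le _ _).trans (ih.1.1.trans (by omega))
    · rw [monicRec]
      simp only [coeff_C_mul, sub_mul, coeff_sub, coeff_X_mul]
      rw [ih.2.2, coeff_eq_zero_of_natDegree_lt (n := n + 1 + 1) (ih.2.1.trans_lt (by omega)),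
        coeff_eq_zero_of_natDegree_lt (n := n + 1 + 1) (ih.1.1.trans_lt (by omega))]
      ring

theorem monicRec_coeff (b c : ℕ → ℂ) (n : ℕ) :
    (monicRec b c (n + 1)).coeff n = -∑ j ∈ Finset.range (n + 1), b j := by
  induction n with
  | zero => simp [monicRec]
  | succ n ih =>
    rw [Finset.sum_range_succ, monicRec]
    simp only [coeff_C_mul, sub_mul, coeff_sub, coeff_X_mul]
    rw [ih, (monicRec_degree b c (n + 1)).2, coeff_eq_zero_of_natDegree_lt (n := n + 1)
      ((monicRec_degree b c n).1.trans_lt (by omega))]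
    ring

variable {μ : ℕ → ℂ} {p : ℕ → ℂ[X]} {a b : ℕ → ℂ}

/-- After normalization only `a²` and `b` enter, so the signs of the `a_n` play no role in the
differentiability of the monic polynomials. -/
theorem IsOrthonormal.eq_monicRec (h : IsOrthonormal μ p) (hr : IsRecurrence p a b) (n : ℕ) :
    p n = C (p n).leadingCoeff * monicRec b (fun k => a (k + 1) ^ 2) n := by
  suffices H : p n = C (p n).leadingCoeff * monicRec b (fun k => a (k + 1) ^ 2) n ∧
      p (n + 1) = C (p (n + 1)).leadingCoeff * monicRec b (fun k => a (k + 1) ^ 2) (n + 1)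
    from H.1
  have hC : ∀ k, C (a (k + 1)) * C (p (k + 1)).leadingCoeff = C (p k).leadingCoeff := fun k => by
    rw [← C_mul, hr.leadingCoeff_eq h]
  induction n with
  | zero =>
    have h0 : p 0 = C (p 0).leadingCoeff := by
      rw [leadingCoeff, h.natDegree_eq]; exact eq_C_of_natDegree_eq_zero (h.natDegree_eq 0)
    refine ⟨by simpa [monicRec] using h0, ?_⟩
    apply mul_left_cancel₀ (C_ne_zero.2 (hr.ne_zero h 0))
    rw [hr.zero, ← mul_assoc, hC 0, monicRec]
    nth_rewrite 1 [h0]; ring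
  | succ n ih =>
    refine ⟨ih.2, ?_⟩
    apply mul_left_cancel₀ (C_ne_zero.2 (hr.ne_zero h (n + 1)))
    rw [hr.succ, ← mul_assoc, hC (n + 1), monicRec]
    nth_rewrite 1 [ih.2, ih.1]
    rw [← hC n, C_pow]
    ring

theorem IsRecurrence.linMap_X_mul_sq (h : IsOrthonormal μ p) (hr : IsRecurrence p a b) (n : ℕ) :
    linMap μ (X * p n ^ 2) = b n := by
  have ho : ∀ i j, linMap μ (p i * p j) = if i = j then 1 else 0 := h.orthonormal
  cases n with
  | zero =>
    have e : X * p 0 ^ 2 = C (a 1) * (p 1 * p 0) + C (b 0) * (p 0 * p 0) := by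
      linear_combination (-p 0) * hr.zero
    rw [e, map_add, linMap_C_mul, linMap_C_mul, ho, ho]; simp
  | succ n =>
    have e : X * p (n + 1) ^ 2 = C (a (n + 2)) * (p (n + 2) * p (n + 1))
        + C (b (n + 1)) * (p (n + 1) * p (n + 1)) + C (a (n + 1)) * (p n * p (n + 1)) := by
      linear_combination (-p (n + 1)) * hr.succ n
    rw [e, map_add, map_add, linMap_C_mul, linMap_C_mul, linMap_C_mul, ho, ho, ho]; simp

end Monic

/-! ### Derivatives of the recurrence coefficients for differentiable moments -/

section Dynamics

variable {𝕜 : Type*} [RCLike 𝕜] [NormedAlgebra 𝕜 ℂ]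

/-- The difference quotient of `g` is that of `g²` divided by `g τ + g t`, which tends to `2 g t ≠
0` by continuity. -/
theorem hasDerivAt_of_sq {g : 𝕜 → ℂ} {c : ℂ} {t : 𝕜} (hg : ContinuousAt g t) (h0 : g t ≠ 0)
    (h : HasDerivAt (fun τ => g τ ^ 2) c t) : HasDerivAt g (c / (2 * g t)) t := by
  rw [hasDerivAt_iff_tendsto_slope] at h ⊢
  have hs : Filter.Tendsto (fun τ => g τ + g t) (nhdsWithin t {t}ᶜ) (nhds (2 * g t)) := by
    rw [two_mul]
    exact (hg.tendsto.add_const _).mono_left nhdsWithin_le_nhds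
  have h2 : (2 * g t) ≠ 0 := mul_ne_zero two_ne_zero h0
  refine (h.div hs h2).congr' ?_
  filter_upwards [hs.eventually_ne h2] with τ hτ
  rw [Pi.div_apply, slope_def_module, slope_def_module, div_eq_iff hτ, smul_mul_assoc]
  congr 1; ring

variable {T : Set 𝕜} (hT : IsOpen T) {μ : 𝕜 → ℕ → ℂ} {μ' : ℕ → ℂ} {p : 𝕜 → ℕ → ℂ[X]}
  {a b : ℕ → 𝕜 → ℂ} (hp : ∀ t ∈ T, IsOrthonormal (μ t) (p t))
  (hab : ∀ t ∈ T, IsRecurrence (p t) (fun n => a n t) (fun n => b n t))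
  {t : 𝕜} (ht : t ∈ T) (hμ : ∀ n, HasDerivAt (fun τ => μ τ n) (μ' n) t)

/-- The monic orthogonal polynomials, as functions of the parameter. -/
noncomputable def monicFamily (a b : ℕ → 𝕜 → ℂ) (n : ℕ) (τ : 𝕜) : ℂ[X] :=
  monicRec (fun k => b k τ) (fun k => a (k + 1) τ ^ 2) n

omit [RCLike 𝕜] [NormedAlgebra 𝕜 ℂ] in
include hp hab in
theorem eq_C_mul_monicFamily {τ : 𝕜} (hτ : τ ∈ T) (n : ℕ) :
    p τ n = C (p τ n).leadingCoeff * monicFamily a b n τ :=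
  (hp τ hτ).eq_monicRec (hab τ hτ) n

omit [RCLike 𝕜] [NormedAlgebra 𝕜 ℂ] in
include hp hab in
theorem monicFamily_mul {τ : 𝕜} (hτ : τ ∈ T) (n : ℕ) (Q : ℂ[X]) :
    linMap (μ τ) (p τ n * Q)
      = (p τ n).leadingCoeff * linMap (μ τ) (monicFamily a b n τ * Q) := by
  rw [← linMap_C_mul, ← mul_assoc]
  congr 2
  exact eq_C_mul_monicFamily hp hab hτ n

omit [RCLike 𝕜] [NormedAlgebra 𝕜 ℂ] in
include hp hab in
theorem linMap_monicFamily_sq {τ : 𝕜} (hτ : τ ∈ T) (n : ℕ) :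
    linMap (μ τ) (monicFamily a b n τ * monicFamily a b n τ)
      = ((p τ n).leadingCoeff ^ 2)⁻¹ := by
  have h := (hp τ hτ).linMap_mul (n := n) (Q := monicFamily a b n τ) (monicRec_degree _ _ n).1
  have h1 : (monicFamily a b n τ).coeff n = 1 := (monicRec_degree _ _ n).2
  rw [monicFamily_mul hp hab hτ, h1] at h
  have hl := (hp τ hτ).leadingCoeff_ne_zero n
  field_simp at h ⊢
  linear_combination h

omit [RCLike 𝕜] [NormedAlgebra 𝕜 ℂ] in
include hp hab in
theorem linMap_monicFamily_mul_eq_zero {τ : 𝕜} (hτ : τ ∈ T) {n : ℕ} {Q : ℂ[X]}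
    (hQ : Q.degree < n) : linMap (μ τ) (monicFamily a b n τ * Q) = 0 := by
  have h := (hp τ hτ).linMap_mul_eq_zero le_rfl hQ
  rw [monicFamily_mul hp hab hτ] at h
  exact (mul_eq_zero.1 h).resolve_left ((hp τ hτ).leadingCoeff_ne_zero n)

theorem HasPolyDerivAt.degree_lt_of_monicFamily {n : ℕ} {P' : ℂ[X]}
    (h : HasPolyDerivAt (monicFamily a b n) P' t) : P'.degree < n := by
  rw [degree_lt_iff_coeff_zero]
  intro i hi
  rcases hi.eq_or_lt with rfl | hi
  · have e : (fun τ => (monicFamily a b n τ).coeff n) = fun _ => 1 :=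
      funext fun τ => (monicRec_degree _ _ n).2
    have := h.2 n
    rw [e] at this
    exact this.unique (hasDerivAt_const t 1)
  · exact coeff_eq_zero_of_natDegree_lt
      ((h.natDegree_le fun τ => (monicRec_degree _ _ n).1).trans_lt hi)

include hp hab ht hμ in
-- Only the moments contribute: the derivative of a monic polynomial has lower degree, hence is
-- orthogonal to it.
theorem HasPolyDerivAt.norm_sq {n : ℕ} {P' : ℂ[X]}
    (h : HasPolyDerivAt (monicFamily a b n) P' t) :
    HasDerivAt (fun τ => linMap (μ τ) (monicFamily a b n τ * monicFamily a b n τ))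
      (linMap μ' (monicFamily a b n t * monicFamily a b n t)) t := by
  convert (h.mul h).hasDerivAt_linMap hμ using 1
  have h0 := linMap_monicFamily_mul_eq_zero hp hab ht h.degree_lt_of_monicFamily
  rw [map_add, mul_comm P', h0]; ring

include hT hp hab ht hμ in
theorem HasPolyDerivAt.recurrence_b {n : ℕ} {P' : ℂ[X]}
    (h : HasPolyDerivAt (monicFamily a b n) P' t) : ∃ b', HasDerivAt (b n) b' t := by
  have h1 := ((HasPolyDerivAt.const X).mul (h.mul h)).hasDerivAt_linMap hμ
  have h2 := h.norm_sq hp hab ht hμ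
  have h0 : linMap (μ t) (monicFamily a b n t * monicFamily a b n t) ≠ 0 := by
    rw [linMap_monicFamily_sq hp hab ht]
    exact inv_ne_zero (pow_ne_zero _ ((hp t ht).leadingCoeff_ne_zero n))
  -- Near `t` the coefficient `b_n` is the quotient `L(z π_n²)/L(π_n²)`, with `π_n` the monic
  -- polynomial.
  refine ⟨_, (h1.fun_div h2 h0).congr_of_eventuallyEq ?_⟩
  filter_upwards [hT.mem_nhds ht] with τ hτ
  have hl := (hp τ hτ).leadingCoeff_ne_zero n
  have hb := (hab τ hτ).linMap_X_mul_sq (hp τ hτ) n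
  have e : X * p τ n ^ 2 = C ((p τ n).leadingCoeff ^ 2)
      * (X * (monicFamily a b n τ * monicFamily a b n τ)) := by
    nth_rewrite 1 [eq_C_mul_monicFamily hp hab hτ n]
    rw [C_pow]; ring
  rw [e, linMap_C_mul] at hb
  rw [linMap_monicFamily_sq hp hab hτ, ← hb]
  field_simp

include hT hp hab ht hμ in
theorem HasPolyDerivAt.recurrence_a_sq {n : ℕ} {P' Q' : ℂ[X]}
    (h : HasPolyDerivAt (monicFamily a b n) P' t)
    (h' : HasPolyDerivAt (monicFamily a b (n + 1)) Q' t) :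
    HasDerivAt (fun τ => a (n + 1) τ ^ 2)
      (a (n + 1) t ^ 2 * (linMap μ' (p t (n + 1) ^ 2) - linMap μ' (p t n ^ 2))) t := by
  have h1 := h.norm_sq hp hab ht hμ
  have h2 := h'.norm_sq hp hab ht hμ
  have hne : ∀ τ ∈ T, linMap (μ τ) (monicFamily a b n τ * monicFamily a b n τ) ≠ 0 := by
    intro τ hτ
    rw [linMap_monicFamily_sq hp hab hτ]
    exact inv_ne_zero (pow_ne_zero _ ((hp τ hτ).leadingCoeff_ne_zero n))
  have e : ∀ k, linMap μ' (p t k ^ 2) = (p t k).leadingCoeff ^ 2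
      * linMap μ' (monicFamily a b k t * monicFamily a b k t) := by
    intro k
    rw [← linMap_C_mul]
    congr 1
    nth_rewrite 1 [eq_C_mul_monicFamily hp hab ht k]
    rw [C_pow]; ring
  -- The classical ratio of consecutive squared norms of the monic polynomials.
  have key : ∀ τ ∈ T, a (n + 1) τ ^ 2
      = linMap (μ τ) (monicFamily a b (n + 1) τ * monicFamily a b (n + 1) τ)
        / linMap (μ τ) (monicFamily a b n τ * monicFamily a b n τ) := by
    intro τ hτ
    have hl := (hp τ hτ).leadingCoeff_ne_zero n
    have hl' := (hp τ hτ).leadingCoeff_ne_zero (n + 1)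
    have := (hab τ hτ).leadingCoeff_eq (hp τ hτ) n
    rw [linMap_monicFamily_sq hp hab hτ, linMap_monicFamily_sq hp hab hτ, ← this]
    field_simp
  have h3 : HasDerivAt (fun τ => a (n + 1) τ ^ 2) _ t :=
    (h2.fun_div h1 (hne t ht)).congr_of_eventuallyEq (by
      filter_upwards [hT.mem_nhds ht] with τ hτ using key τ hτ)
  convert h3 using 1
  have hl := (hp t ht).leadingCoeff_ne_zero n
  have hl' := (hp t ht).leadingCoeff_ne_zero (n + 1)
  rw [e, e, key t ht, linMap_monicFamily_sq hp hab ht, linMap_monicFamily_sq hp hab ht]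
  field_simp

include hT hp hab ht hμ in
-- A bootstrap along the recurrence: differentiability of two consecutive monic polynomials gives
-- that of `b_{n+1}` and `a_{n+1}²`, hence of the next polynomial.
theorem exists_hasPolyDerivAt (n : ℕ) : ∃ P', HasPolyDerivAt (monicFamily a b n) P' t := by
  suffices H : (∃ P', HasPolyDerivAt (monicFamily a b n) P' t) ∧
      ∃ P', HasPolyDerivAt (monicFamily a b (n + 1)) P' t from H.1
  induction n with
  | zero =>
    have h0 : HasPolyDerivAt (monicFamily a b 0) 0 t := HasPolyDerivAt.const 1
    obtain ⟨b', hb⟩ := h0.recurrence_b hT hp hab ht hμ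
    exact ⟨⟨_, h0⟩, _, (HasPolyDerivAt.const X).sub (hasPolyDerivAt_C hb)⟩
  | succ n ih =>
    obtain ⟨⟨P', hP⟩, Q', hQ⟩ := ih
    obtain ⟨b', hb⟩ := hQ.recurrence_b hT hp hab ht hμ
    have ha := hP.recurrence_a_sq hT hp hab ht hμ hQ
    exact ⟨⟨_, hQ⟩, _, (((HasPolyDerivAt.const X).sub (hasPolyDerivAt_C hb)).mul hQ).sub
      ((hasPolyDerivAt_C ha).mul hP)⟩

include hT hp hab ht hμ in
theorem hasDerivAt_recurrence_a {n : ℕ} (ha : ContinuousAt (a (n + 1)) t) :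
    HasDerivAt (a (n + 1))
      (a (n + 1) t * (1 / 2 * (linMap μ' (p t (n + 1) ^ 2) - linMap μ' (p t n ^ 2)))) t := by
  obtain ⟨P', hP⟩ := exists_hasPolyDerivAt hT hp hab ht hμ n
  obtain ⟨Q', hQ⟩ := exists_hasPolyDerivAt hT hp hab ht hμ (n + 1)
  have h0 : a (n + 1) t ≠ 0 := (hab t ht).ne_zero (hp t ht) n
  convert hasDerivAt_of_sq ha h0 (hP.recurrence_a_sq hT hp hab ht hμ hQ) using 1
  field_simp

include hT hp hab ht hμ in
-- Differentiate `L(π_{n+1} π_n) = 0` for the monic `π`. The term with `π̇_n` vanishes by degree.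
-- Since `π_{n+1}` has subleading coefficient `-(b_0 + … + b_n)`, the pairing of `π̇_{n+1}` with
-- `π_n` yields exactly the sum of the `ḃ_j`; this is why sums appear.
theorem hasDerivAt_recurrence_b : ∃ b' : ℕ → ℂ, (∀ n, HasDerivAt (b n) (b' n) t) ∧
    ∀ n, ∑ j ∈ Finset.range (n + 1), b' j
      = a (n + 1) t * linMap μ' (p t (n + 1) * p t n) := by
  choose P' hP using exists_hasPolyDerivAt hT hp hab ht hμ
  choose b' hb using fun n => (hP n).recurrence_b hT hp hab ht hμ
  refine ⟨b', hb, fun n => ?_⟩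
  have h1 := ((hP (n + 1)).mul (hP n)).hasDerivAt_linMap hμ
  have hz : (fun τ => linMap (μ τ) (monicFamily a b (n + 1) τ * monicFamily a b n τ))
      =ᶠ[nhds t] fun _ => 0 := by
    filter_upwards [hT.mem_nhds ht] with τ hτ
    refine linMap_monicFamily_mul_eq_zero hp hab hτ (degree_le_natDegree.trans_lt ?_)
    exact_mod_cast Nat.lt_succ_of_le (monicRec_degree _ _ n).1
  have h2 := h1.unique ((hasDerivAt_const t (0 : ℂ)).congr_of_eventuallyEq hz)
  rw [map_add, linMap_monicFamily_mul_eq_zero hp hab ht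
    ((hP n).degree_lt_of_monicFamily.trans_le (by exact_mod_cast n.le_succ))] at h2
  have hcoef : (P' (n + 1)).coeff n = -∑ j ∈ Finset.range (n + 1), b' j := by
    have e : (fun τ => (monicFamily a b (n + 1) τ).coeff n)
        = fun τ => -∑ j ∈ Finset.range (n + 1), b j τ :=
      funext fun τ => monicRec_coeff _ _ n
    have := (hP (n + 1)).2 n
    rw [e] at this
    exact this.unique (HasDerivAt.fun_sum fun j _ => hb j).fun_neg
  have hdeg : (P' (n + 1)).natDegree ≤ n := by
    have h := (hP (n + 1)).degree_lt_of_monicFamily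
    rw [degree_lt_iff_coeff_zero] at h
    exact natDegree_le_iff_coeff_eq_zero.2 fun i hi => h i hi
  have h3 := (hp t ht).linMap_mul hdeg
  rw [monicFamily_mul hp hab ht, hcoef, mul_comm (monicFamily a b n t)] at h3
  have hl := (hp t ht).leadingCoeff_ne_zero n
  have hl' := (hp t ht).leadingCoeff_ne_zero (n + 1)
  have hk : a (n + 1) t * (p t (n + 1)).leadingCoeff = (p t n).leadingCoeff :=
    (hab t ht).leadingCoeff_eq (hp t ht) n
  have e : p t (n + 1) * p t n = C ((p t (n + 1)).leadingCoeff * (p t n).leadingCoeff)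
      * (monicFamily a b (n + 1) t * monicFamily a b n t) := by
    rw [C_mul, mul_mul_mul_comm, ← eq_C_mul_monicFamily hp hab ht (n + 1),
      ← eq_C_mul_monicFamily hp hab ht n]
  rw [e, linMap_C_mul]
  generalize linMap (μ t) (P' (n + 1) * monicFamily a b n t) = u at h2 h3
  generalize linMap μ' (monicFamily a b (n + 1) t * monicFamily a b n t) = v at h2 ⊢
  generalize (p t n).leadingCoeff = κ at *
  generalize (p t (n + 1)).leadingCoeff = κ' at *
  field_simp at h3
  linear_combination (-κ * v) * hk - κ ^ 2 * h2 + h3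

end Dynamics

open Set Filter Topology MeasureTheory

/-! ### Branches of logarithms -/

theorem exists_eq_of_exp_eq_one {X : Type*} [TopologicalSpace X] {S : Set X}
    (hS : IsPreconnected S) {h : X → ℂ} (hc : ContinuousOn h S)
    (he : ∀ q ∈ S, Complex.exp (h q) = 1) : ∃ c, ∀ q ∈ S, h q = c := by
  have hex : ∀ q, ∃ n : ℤ, q ∈ S → h q = n * (2 * Real.pi * Complex.I) := by
    intro q
    by_cases hq : q ∈ S
    · obtain ⟨n, hn⟩ := Complex.exp_eq_one_iff.1 (he q hq)
      exact ⟨n, fun _ => hn⟩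
    · exact ⟨0, fun hq' => absurd hq' hq⟩
  choose n hn using hex
  have hcn : ContinuousOn n S := by
    rw [Int.isClosedEmbedding_coe_real.isEmbedding.continuousOn_iff]
    have h2 : ContinuousOn (fun q => (h q).im / (2 * Real.pi)) S :=
      (Complex.continuous_im.comp_continuousOn hc).div_const _
    refine h2.congr fun q hq => ?_
    have hpi := Real.pi_ne_zero
    change (n q : ℝ) = (h q).im / (2 * Real.pi)
    rw [hn q hq]
    simp
  rcases S.eq_empty_or_nonempty with rfl | ⟨q₀, hq₀⟩
  · exact ⟨0, fun q hq => absurd hq (notMem_empty q)⟩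
  · exact ⟨h q₀, fun q hq => by rw [hn q hq, hn q₀ hq₀, hS.constant hcn hq hq₀]⟩

/-- For complex `α` the modulus also depends on the imaginary part of `ℓ`. On a connected set `ℓ`
differs from `log ρ + log (u/c)` by a constant; `log (u/c)` is bounded as `u` stays near `c`, and
`log ρ` is real, which leaves `ρ ^ Re α`. -/
theorem exists_norm_exp_mul_le {X : Type*} [TopologicalSpace X] {S : Set X}
    (hS : IsPreconnected S) {ℓ u : X → ℂ} {ρ : X → ℝ} (hℓ : ContinuousOn ℓ S)
    (hu : ContinuousOn u S) (hρ : ContinuousOn ρ S) (hρ0 : ∀ q ∈ S, 0 < ρ q)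
    (he : ∀ q ∈ S, Complex.exp (ℓ q) = ρ q * u q) {c : ℂ} (hc : c ≠ 0)
    (huc : ∀ q ∈ S, ‖u q - c‖ ≤ ‖c‖ / 2) (α : ℂ) :
    ∃ C, ∀ q ∈ S, ‖Complex.exp (α * ℓ q)‖ ≤ C * ρ q ^ α.re := by
  have hn : ∀ q ∈ S, ‖(u q - c) / c‖ ≤ 1 / 2 := by
    intro q hq
    rw [norm_div, div_le_iff₀ (norm_pos_iff.2 hc)]
    linarith [huc q hq]
  have hv : ∀ q, 1 + (u q - c) / c = u q / c := fun q => by field_simp; ring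
  have hslit : ∀ q ∈ S, u q / c ∈ Complex.slitPlane := fun q hq => by
    rw [← hv]
    exact Complex.mem_slitPlane_of_norm_lt_one ((hn q hq).trans_lt (by norm_num))
  obtain ⟨H, hH⟩ := exists_eq_of_exp_eq_one hS
    (h := fun q => ℓ q - (Real.log (ρ q) : ℂ) - Complex.log (u q / c) - Complex.log c)
    (((hℓ.sub (Complex.continuous_ofReal.comp_continuousOn
      (hρ.log fun q hq => (hρ0 q hq).ne'))).sub
      ((hu.div_const c).clog hslit)).sub continuousOn_const) (fun q hq => by
        have h1 : u q / c ≠ 0 := Complex.slitPlane_ne_zero (hslit q hq)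
        have h2 : (ρ q : ℂ) ≠ 0 := Complex.ofReal_ne_zero.2 (hρ0 q hq).ne'
        rw [Complex.exp_sub, Complex.exp_sub, Complex.exp_sub, Complex.exp_log h1,
          Complex.exp_log hc, he q hq, ← Complex.ofReal_exp, Real.exp_log (hρ0 q hq)]
        field_simp at h1 ⊢
        exact div_self (by simpa [hc] using h1))
  -- The factor `3/2 * 1/2` comes from `‖log (1 + w)‖ ≤ 3/2 ‖w‖` for `‖w‖ ≤ 1/2`, with `w = (u -
  -- c)/c`.
  refine ⟨‖Complex.exp (α * (Complex.log c + H))‖ * Real.exp (‖α‖ * (3 / 2 * (1 / 2))),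
    fun q hq => ?_⟩
  have e : α * ℓ q = α * (Complex.log c + H) + α * Complex.log (u q / c)
      + α * (Real.log (ρ q) : ℂ) := by
    rw [← hH q hq]; ring
  rw [e, Complex.exp_add, Complex.exp_add, norm_mul, norm_mul]
  have h1 : ‖Complex.exp (α * (Real.log (ρ q) : ℂ))‖ = ρ q ^ α.re := by
    rw [Complex.norm_exp, Real.rpow_def_of_pos (hρ0 q hq)]
    simp [mul_comm]
  have h2 : ‖Complex.exp (α * Complex.log (u q / c))‖ ≤ Real.exp (‖α‖ * (3 / 2 * (1 / 2))) := by
    refine (Complex.norm_exp_le_exp_norm _).trans (Real.exp_le_exp.2 ?_)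
    rw [norm_mul, ← hv]
    gcongr
    exact (Complex.norm_log_one_add_half_le_self (hn q hq)).trans (by gcongr; exact hn q hq)
  have h3 := Real.rpow_nonneg (hρ0 q hq).le α.re
  rw [h1]
  gcongr

section Deriv

variable {𝕜 : Type*} [RCLike 𝕜] [NormedAlgebra 𝕜 ℂ]

/-- By continuity `ℓ` coincides near `t` with `f` followed by the local inverse of `exp` at `ℓ t`.
-/
theorem hasDerivAt_of_exp_eq {ℓ f : 𝕜 → ℂ} {f' : ℂ} {t : 𝕜} (hℓ : ContinuousAt ℓ t)
    (he : ∀ᶠ τ in 𝓝 t, Complex.exp (ℓ τ) = f τ) (hf : HasDerivAt f f' t) :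
    HasDerivAt ℓ (f' / f t) t := by
  have hs := Complex.hasStrictDerivAt_exp (ℓ t)
  have h0 := Complex.exp_ne_zero (ℓ t)
  have hft : Complex.exp (ℓ t) = f t := he.self_of_nhds
  have h1 := hs.to_localInverse h0
  have h2 := hs.eventually_left_inverse h0
  have h3 : HasDerivAt (HasStrictDerivAt.localInverse Complex.exp (Complex.exp (ℓ t)) (ℓ t) hs h0)
      (Complex.exp (ℓ t))⁻¹ (f t) := hft ▸ h1.hasDerivAt
  have h4 := (h3.comp t hf).congr_of_eventuallyEq (f₁ := ℓ) (by
    filter_upwards [hℓ.eventually h2, he] with τ h5 h6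
    rw [Function.comp_apply, ← h6, h5])
  exact h4.congr_deriv (by rw [hft]; ring)

theorem hasDerivAt_prod_exp {m : ℕ} (α : Fin m → ℂ) {f : Fin m → 𝕜 → ℂ} {f' : Fin m → ℂ} {t : 𝕜}
    (h : ∀ k, HasDerivAt (f k) (f' k) t) :
    HasDerivAt (fun τ => ∏ k, Complex.exp (α k * f k τ))
      ((∏ k, Complex.exp (α k * f k t)) * ∑ k, α k * f' k) t := by
  simp only [← Complex.exp_sum]
  exact (Complex.hasDerivAt_exp _).comp t (HasDerivAt.fun_sum fun k _ => (h k).const_mul (α k))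

theorem hasDerivAt_polynomial_comp (P : ℂ[X]) {f : 𝕜 → ℂ} {f' : ℂ} {t : 𝕜}
    (h : HasDerivAt f f' t) :
    HasDerivAt (fun τ => P.eval (f τ)) ((derivative P).eval (f t) * f') t :=
  (P.hasDerivAt (f t)).comp t h

end Deriv

/-! ### Local bounds on curve families -/

section Local

variable {𝕜 : Type*} [RCLike 𝕜]

theorem exists_uniform_of_local {t : 𝕜} {P : ℝ → 𝕜 → ℝ → Prop}
    (mono : ∀ C C' τ s, C ≤ C' → P C τ s → P C' τ s)
    (h : ∀ s₀ ∈ Icc (0 : ℝ) 1, ∃ C, ∀ᶠ q in 𝓝 (t, s₀), P C q.1 q.2) :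
    ∃ C, ∀ᶠ τ in 𝓝 t, ∀ s ∈ Icc (0 : ℝ) 1, P C τ s := by
  refine (isCompact_Icc (a := (0 : ℝ)) (b := 1)).induction_on
    (p := fun S => ∃ C, ∀ᶠ τ in 𝓝 t, ∀ s ∈ S, P C τ s) ⟨0, by simp⟩ ?_ ?_ ?_
  · rintro S S' hSS ⟨C, hC⟩
    exact ⟨C, hC.mono fun τ hτ s hs => hτ s (hSS hs)⟩
  · rintro S S' ⟨C, hC⟩ ⟨C', hC'⟩
    refine ⟨max C C', ?_⟩
    filter_upwards [hC, hC'] with τ h1 h2 s hs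
    rcases hs with hs | hs
    · exact mono _ _ _ _ (le_max_left _ _) (h1 s hs)
    · exact mono _ _ _ _ (le_max_right _ _) (h2 s hs)
  · intro s₀ hs₀
    obtain ⟨C, hC⟩ := h s₀ hs₀
    rw [nhds_prod_eq] at hC
    obtain ⟨pa, hpa, pb, hpb, hab⟩ := eventually_prod_iff.1 hC
    exact ⟨{s | pb s}, mem_nhdsWithin_of_mem_nhds hpb, C,
      hpa.mono fun τ hτ s hs => hab hτ hs⟩

theorem exists_bound_of_continuousOn {T : Set 𝕜} (hT : IsOpen T) {t : 𝕜} (ht : t ∈ T)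
    {F : 𝕜 → ℝ → ℂ} (hF : ContinuousOn (fun q : 𝕜 × ℝ => F q.1 q.2) (T ×ˢ Icc (0 : ℝ) 1)) :
    ∃ C, ∀ᶠ τ in 𝓝 t, ∀ s ∈ Icc (0 : ℝ) 1, ‖F τ s‖ ≤ C := by
  obtain ⟨C, hC⟩ := exists_uniform_of_local (t := t)
    (P := fun C τ s => τ ∈ T → s ∈ Icc (0 : ℝ) 1 → ‖F τ s‖ ≤ C)
    (fun C C' τ s hCC h h1 h2 => (h h1 h2).trans hCC) (fun s₀ hs₀ => by
      refine ⟨‖F t s₀‖ + 1, ?_⟩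
      have h1 := (hF (t, s₀) ⟨ht, hs₀⟩).norm.eventually (gt_mem_nhds (lt_add_one _))
      rw [eventually_nhdsWithin_iff] at h1
      exact h1.mono fun q hq h2 h3 => (hq ⟨h2, h3⟩).le)
  refine ⟨C, ?_⟩
  filter_upwards [hC, hT.mem_nhds ht] with τ h1 h2 s hs using h1 s hs h2 hs

variable [NormedAlgebra 𝕜 ℂ] {T : Set 𝕜} {γ : 𝕜 → ℝ → ℂ}

omit [NormedAlgebra 𝕜 ℂ] in
theorem continuousOn_slice {F : 𝕜 × ℝ → ℂ} {I : Set ℝ} (hF : ContinuousOn F (T ×ˢ I)) {t : 𝕜}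
    (ht : t ∈ T) : ContinuousOn (fun s => F (t, s)) I :=
  hF.comp (Continuous.prodMk_right t).continuousOn fun _ hs => ⟨ht, hs⟩

theorem IsCurveFamily.hasDerivAt_s (h : IsCurveFamily T γ) {t : 𝕜} (ht : t ∈ T) {s : ℝ}
    (hs : s ∈ Icc (0 : ℝ) 1) : HasDerivAt (γ t) (deriv (γ t) s) s :=
  (h.diff_s t ht s hs).hasDerivAt

theorem IsCurveFamily.hasDerivAt_t (h : IsCurveFamily T γ) {t : 𝕜} (ht : t ∈ T) {s : ℝ}
    (hs : s ∈ Icc (0 : ℝ) 1) : HasDerivAt (fun τ => γ τ s) (deriv (fun τ => γ τ s) t) t :=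
  (h.diff_t t ht s hs).hasDerivAt

theorem IsCurveFamily.hasDerivAt_ts (h : IsCurveFamily T γ) {t : 𝕜} (ht : t ∈ T) {s : ℝ}
    (hs : s ∈ Icc (0 : ℝ) 1) :
    HasDerivAt (fun τ => deriv (γ τ) s) (deriv (fun τ => deriv (γ τ) s) t) t :=
  (h.diff_ts t ht s hs).hasDerivAt

theorem uIcc_subset_unit {s₁ s₂ : ℝ} (h₁ : s₁ ∈ Icc (0 : ℝ) 1) (h₂ : s₂ ∈ Icc (0 : ℝ) 1) :
    uIcc s₁ s₂ ⊆ Icc (0 : ℝ) 1 :=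
  (convex_Icc (0 : ℝ) 1).ordConnected.uIcc_subset h₁ h₂

/-- `∂γ/∂t` is an antiderivative of `∂²γ/∂t∂s`. -/
theorem IsCurveFamily.deriv_t_sub (hT : IsOpen T) (h : IsCurveFamily T γ) {t : 𝕜} (ht : t ∈ T)
    {s₁ s₂ : ℝ} (h₁ : s₁ ∈ Icc (0 : ℝ) 1) (h₂ : s₂ ∈ Icc (0 : ℝ) 1) :
    deriv (fun τ => γ τ s₂) t - deriv (fun τ => γ τ s₁) t
      = ∫ u in s₁..s₂, deriv (fun τ => deriv (γ τ) u) t := by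
  have hsub := uIcc_subset_unit h₁ h₂
  have hcs : ∀ τ ∈ T, ContinuousOn (deriv (γ τ)) (uIcc s₁ s₂) := fun τ hτ =>
    (continuousOn_slice h.cont_s hτ).mono hsub
  have hcts : ContinuousOn (fun u => deriv (fun τ => deriv (γ τ) u) t) (uIcc s₁ s₂) :=
    (continuousOn_slice h.cont_ts ht).mono hsub
  obtain ⟨C, hC⟩ := exists_bound_of_continuousOn hT ht
    (F := fun t s => deriv (fun τ => deriv (γ τ) s) t) h.cont_ts
  have hint : ∀ τ ∈ T, ∫ u in s₁..s₂, deriv (γ τ) u = γ τ s₂ - γ τ s₁ := fun τ hτ =>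
    intervalIntegral.integral_eq_sub_of_hasDerivAt
      (fun u hu => h.hasDerivAt_s hτ (hsub hu)) (hcs τ hτ).intervalIntegrable
  have hev : ∀ᶠ τ in 𝓝 t, τ ∈ T := hT.mem_nhds ht
  -- The increment of `γ τ` is the integral of its velocity; differentiate this in `τ` under the
  -- integral sign.
  have key := (intervalIntegral.hasDerivAt_integral_of_dominated_loc_of_deriv_le
    (μ := volume) (a := s₁) (b := s₂) (bound := fun _ => C)
    (F := fun τ u => deriv (γ τ) u) (F' := fun τ u => deriv (fun τ => deriv (γ τ) u) τ)
    (s := {τ | (∀ s ∈ Icc (0 : ℝ) 1, ‖deriv (fun τ => deriv (γ τ) s) τ‖ ≤ C) ∧ τ ∈ T})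
    (hC.and hev)
    (hev.mono fun τ hτ => ((hcs τ hτ).mono uIoc_subset_uIcc).aestronglyMeasurable
      measurableSet_uIoc)
    (hcs t ht).intervalIntegrable
    ((hcts.mono uIoc_subset_uIcc).aestronglyMeasurable measurableSet_uIoc)
    (Eventually.of_forall fun u hu τ hτ => hτ.1 u (hsub (uIoc_subset_uIcc hu)))
    intervalIntegrable_const
    (Eventually.of_forall fun u hu τ hτ =>
      h.hasDerivAt_ts hτ.2 (hsub (uIoc_subset_uIcc hu)))).2
  refine HasDerivAt.unique (((h.hasDerivAt_t ht h₂).fun_sub (h.hasDerivAt_t ht h₁))) ?_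
  exact key.congr_of_eventuallyEq (hev.mono fun τ hτ => (hint τ hτ).symm)

/-- Equality of the mixed partial derivatives: only one order is assumed to exist, and the other
comes from the integral formula `deriv_t_sub`. -/
theorem IsCurveFamily.hasDerivAt_deriv_t (hT : IsOpen T) (h : IsCurveFamily T γ) {t : 𝕜}
    (ht : t ∈ T) {s : ℝ} (hs : s ∈ Ioo (0 : ℝ) 1) :
    HasDerivAt (fun s => deriv (fun τ => γ τ s) t) (deriv (fun τ => deriv (γ τ) s) t) s := by
  have hc : ContinuousOn (fun u => deriv (fun τ => deriv (γ τ) u) t) (Icc 0 1) :=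
    continuousOn_slice h.cont_ts ht
  have hs' := Ioo_subset_Icc_self hs
  have h0 : (0 : ℝ) ∈ Icc (0 : ℝ) 1 := ⟨le_rfl, zero_le_one⟩
  have h1 := intervalIntegral.integral_hasDerivAt_right
    (hc.mono (uIcc_subset_unit h0 hs')).intervalIntegrable
    ((hc.mono Ioo_subset_Icc_self).stronglyMeasurableAtFilter isOpen_Ioo s hs)
    (hc.continuousAt (Icc_mem_nhds hs.1 hs.2))
  refine ((h1.const_add (deriv (fun τ => γ τ 0) t)).congr_of_eventuallyEq ?_)
  filter_upwards [Ioo_mem_nhds hs.1 hs.2] with u hu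
  rw [← h.deriv_t_sub hT ht h0 (Ioo_subset_Icc_self hu)]
  ring

theorem IsCurveFamily.norm_deriv_t_sub_le (hT : IsOpen T) (h : IsCurveFamily T γ) {t : 𝕜}
    (ht : t ∈ T) : ∃ C, ∀ᶠ τ in 𝓝 t, ∀ s₁ ∈ Icc (0 : ℝ) 1, ∀ s₂ ∈ Icc (0 : ℝ) 1,
      ‖deriv (fun τ => γ τ s₂) τ - deriv (fun τ => γ τ s₁) τ‖ ≤ C * |s₂ - s₁| := by
  obtain ⟨C, hC⟩ := exists_bound_of_continuousOn hT ht
    (F := fun t s => deriv (fun τ => deriv (γ τ) s) t) h.cont_ts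
  refine ⟨C, ?_⟩
  filter_upwards [hC, hT.mem_nhds ht] with τ h1 hτ s₁ hs₁ s₂ hs₂
  rw [h.deriv_t_sub hT hτ hs₁ hs₂]
  exact intervalIntegral.norm_integral_le_of_norm_le_const fun u hu =>
    h1 u (uIcc_subset_unit hs₁ hs₂ (uIoc_subset_uIcc hu))

/-- Uniform first order expansion of the curves at the parameter `s₀`. -/
theorem IsCurveFamily.eventually_norm_sub_le (h : IsCurveFamily T γ) (hT : IsOpen T) {t : 𝕜}
    (ht : t ∈ T) {s₀ : ℝ} (hs₀ : s₀ ∈ Icc (0 : ℝ) 1) {η : ℝ} (hη : 0 < η) :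
    ∀ᶠ q in 𝓝 (t, s₀), q.2 ∈ Icc (0 : ℝ) 1 →
      ‖γ q.1 q.2 - γ q.1 s₀ - ((q.2 - s₀ : ℝ) : ℂ) * deriv (γ t) s₀‖ ≤ η * |q.2 - s₀| := by
  have h1 := (h.cont_s (t, s₀) ⟨ht, hs₀⟩).eventually (Metric.ball_mem_nhds _ hη)
  rw [eventually_nhdsWithin_iff] at h1
  have h2 : ∀ᶠ q : 𝕜 × ℝ in 𝓝 (t, s₀), q.1 ∈ T :=
    continuous_fst.continuousAt.eventually (hT.mem_nhds ht)
  obtain ⟨ε, hε, hb⟩ := Metric.eventually_nhds_iff_ball.1 (h1.and h2)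
  refine Metric.eventually_nhds_iff_ball.2 ⟨ε, hε, fun q hq hq2 => ?_⟩
  rw [← ball_prod_same] at hq hb
  have hqT : q.1 ∈ T := (hb q hq).2
  have key := Convex.norm_image_sub_le_of_norm_hasDerivWithin_le (𝕜 := ℝ)
    (f := fun s => γ q.1 s - (s : ℂ) * deriv (γ t) s₀)
    (f' := fun s => deriv (γ q.1) s - deriv (γ t) s₀)
    (s := Metric.ball s₀ ε ∩ Icc 0 1) (x := s₀) (y := q.2) (C := η)
    (fun s hs => (((h.hasDerivAt_s hqT hs.2).sub
      (Complex.ofRealCLM.hasDerivAt.mul_const (deriv (γ t) s₀))).congr_deriv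
        (by simp)).hasDerivWithinAt)
    (fun s hs => by
      have := (hb (q.1, s) ⟨hq.1, hs.1⟩).1 ⟨hqT, hs.2⟩
      rw [dist_eq_norm] at this
      exact this.le)
    ((convex_ball _ _).inter (convex_Icc _ _)) ⟨Metric.mem_ball_self hε, hs₀⟩ ⟨hq.2, hq2⟩
  rw [Real.norm_eq_abs] at key
  have e : γ q.1 q.2 - γ q.1 s₀ - ((q.2 - s₀ : ℝ) : ℂ) * deriv (γ t) s₀
      = γ q.1 q.2 - q.2 * deriv (γ t) s₀ - (γ q.1 s₀ - s₀ * deriv (γ t) s₀) := by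
    push_cast; ring
  rw [e]
  exact key

end Local

/-! ### Bounds on the weight along a curve family -/

/-- A majorant on `(0, 1)` of a weight with exponents `β₀` and `β₁` at the ends. -/
noncomputable def endWeight (β₀ β₁ : ℝ) (s : ℝ) : ℝ := 1 + s ^ β₀ + (1 - s) ^ β₁

section EndWeight

variable {β₀ β₁ : ℝ}

theorem one_le_endWeight {s : ℝ} (hs : s ∈ Ioo (0 : ℝ) 1) : 1 ≤ endWeight β₀ β₁ s := by
  have h1 := Real.rpow_nonneg hs.1.le β₀
  have h2 := Real.rpow_nonneg (sub_nonneg.2 hs.2.le) β₁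
  unfold endWeight; linarith

theorem rpow_le_endWeight {s : ℝ} (hs : s ∈ Ioo (0 : ℝ) 1) : s ^ β₀ ≤ endWeight β₀ β₁ s := by
  have h2 := Real.rpow_nonneg (sub_nonneg.2 hs.2.le) β₁
  unfold endWeight; linarith

theorem one_sub_rpow_le_endWeight {s : ℝ} (hs : s ∈ Ioo (0 : ℝ) 1) :
    (1 - s) ^ β₁ ≤ endWeight β₀ β₁ s := by
  have h1 := Real.rpow_nonneg hs.1.le β₀
  unfold endWeight; linarith

theorem intervalIntegrable_endWeight (h₀ : -1 < β₀) (h₁ : -1 < β₁) :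
    IntervalIntegrable (endWeight β₀ β₁) volume 0 1 := by
  refine (intervalIntegrable_const.add (intervalIntegral.intervalIntegrable_rpow' h₀)).add ?_
  have := (intervalIntegral.intervalIntegrable_rpow' (a := 0) (b := 1) h₁).comp_sub_left 1
  simpa using this.symm

theorem tendsto_mul_endWeight_zero (h₀ : -1 < β₀) :
    Tendsto (fun s => s * endWeight β₀ β₁ s) (𝓝[>] 0) (𝓝 0) := by
  have h1 : Tendsto (fun s : ℝ => s + s ^ (1 + β₀) + s * (1 - s) ^ β₁) (𝓝 0) (𝓝 0) := by
    have e : (0 : ℝ) = 0 + (0 : ℝ) ^ (1 + β₀) + 0 * (1 - 0) ^ β₁ := by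
      rw [Real.zero_rpow (by linarith)]; ring
    nth_rewrite 2 [e]
    refine (tendsto_id.add ?_).add (tendsto_id.mul ?_)
    · exact (Real.continuousAt_rpow_const 0 (1 + β₀) (Or.inr (by linarith))).tendsto
    · exact ((continuous_const.sub continuous_id).continuousAt.rpow_const
        (Or.inl (by norm_num))).tendsto
  refine (h1.mono_left nhdsWithin_le_nhds).congr' ?_
  filter_upwards [self_mem_nhdsWithin] with s hs
  rw [endWeight, Real.rpow_add hs, Real.rpow_one]; ring

theorem tendsto_mul_endWeight_one (h₁ : -1 < β₁) :
    Tendsto (fun s => (1 - s) * endWeight β₀ β₁ s) (𝓝[<] 1) (𝓝 0) := by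
  have h2 : Tendsto (fun s : ℝ => 1 - s) (𝓝[<] 1) (𝓝[>] 0) := by
    refine tendsto_nhdsWithin_of_tendsto_nhds_of_eventually_within _ ?_ ?_
    · have : Tendsto (fun s : ℝ => 1 - s) (𝓝 1) (𝓝 (1 - 1)) := tendsto_const_nhds.sub tendsto_id
      rw [sub_self] at this
      exact this.mono_left nhdsWithin_le_nhds
    · filter_upwards [self_mem_nhdsWithin] with s hs using sub_pos.2 (mem_Iio.1 hs)
  refine ((tendsto_mul_endWeight_zero (β₀ := β₁) (β₁ := β₀) h₁).comp h2).congr fun s => ?_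
  simp only [Function.comp_apply, endWeight, sub_sub_cancel]; ring

end EndWeight

/-! ### Joining arcs and closed contours under common estimates -/

section Admissible

variable {𝕜 : Type*} [RCLike 𝕜] [NormedAlgebra 𝕜 ℂ] {T : Set 𝕜} {m : ℕ}
  {x : Fin m → 𝕜 → ℂ} {α : Fin m → ℂ} {γ : 𝕜 → ℝ → ℂ} {ℓ : Fin m → 𝕜 → ℝ → ℂ}

/-- A common framework for joining arcs and closed contours: the curves meet the points `xₖ` at
most at their ends, where the exponents have real parts `β₀` and `β₁`. -/
structure IsAdmissible (T : Set 𝕜) (x : Fin m → 𝕜 → ℂ) (α : Fin m → ℂ) (γ : 𝕜 → ℝ → ℂ)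
    (ℓ : Fin m → 𝕜 → ℝ → ℂ) (β₀ β₁ : ℝ) : Prop where
  family : IsCurveFamily T γ
  log : IsLogBranch T (Ioo 0 1) x γ ℓ
  gt₀ : -1 < β₀
  gt₁ : -1 < β₁
  hit : ∀ t ∈ T, ∀ s ∈ Icc (0 : ℝ) 1, ∀ k, γ t s = x k t →
    deriv (γ t) s ≠ 0 ∧ (∀ τ ∈ T, γ τ s = x k τ) ∧
      (s = 0 ∧ (α k).re = β₀ ∨ s = 1 ∧ (α k).re = β₁)

omit [NormedAlgebra 𝕜 ℂ] in
theorem IsLogBranch.mono {I J : Set ℝ} (h : IsLogBranch T I x γ ℓ) (hJ : J ⊆ I) :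
    IsLogBranch T J x γ ℓ :=
  ⟨fun k => (h.cont k).mono (prod_mono le_rfl hJ), fun k t ht s hs => h.exp_eq k t ht s (hJ hs)⟩

omit [NormedAlgebra 𝕜 ℂ] in
theorem IsLogBranch.ne {I : Set ℝ} (h : IsLogBranch T I x γ ℓ) {t : 𝕜} (ht : t ∈ T) {s : ℝ}
    (hs : s ∈ I) (k : Fin m) : γ t s - x k t ≠ 0 := by
  rw [← h.exp_eq k t ht s hs]; exact Complex.exp_ne_zero _

theorem IsClosedContour.isAdmissible (h : IsClosedContour T x α γ ℓ) :
    IsAdmissible T x α γ ℓ 0 0 where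
  family := h.family
  log := h.log.mono Ioo_subset_Icc_self
  gt₀ := by norm_num
  gt₁ := by norm_num
  hit t ht s hs k hk := absurd (sub_eq_zero.2 hk) (h.log.ne ht hs k)

theorem IsJoiningArc.isAdmissible (hx : ∀ t ∈ T, Function.Injective fun k => x k t)
    (h : IsJoiningArc T x α γ ℓ) : ∃ β₀ β₁, IsAdmissible T x α γ ℓ β₀ β₁ := by
  obtain ⟨i, hi, hi'⟩ := h.source
  obtain ⟨j, hj, hj'⟩ := h.target
  refine ⟨(α i).re, (α j).re, h.family, h.log, hi, hj, fun t ht s hs k hk => ?_⟩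
  rcases hs.1.eq_or_lt with rfl | h0
  · have : k = i := hx t ht (hk.symm.trans (hi' t ht))
    subst this
    exact ⟨h.tangent_source t ht, hi', Or.inl ⟨rfl, rfl⟩⟩
  · rcases hs.2.eq_or_lt with rfl | h1
    · have : k = j := hx t ht (hk.symm.trans (hj' t ht))
      subst this
      exact ⟨h.tangent_target t ht, hj', Or.inr ⟨rfl, rfl⟩⟩
    · exact absurd (sub_eq_zero.2 hk) (h.log.ne ht ⟨h0, h1⟩ k)

variable {β₀ β₁ : ℝ} (hT : IsOpen T) (hx : ∀ k, DifferentiableOn 𝕜 (x k) T)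
  (hx' : ∀ k, ContinuousOn (deriv (x k)) T)
  (h : IsAdmissible T x α γ ℓ β₀ β₁) {t : 𝕜} (ht : t ∈ T)

include hx in
omit h ht in
theorem continuousOn_x (k : Fin m) (I : Set ℝ) :
    ContinuousOn (fun q : 𝕜 × ℝ => x k q.1) (T ×ˢ I) :=
  (hx k).continuousOn.comp continuousOn_fst fun _ hq => hq.1

include hx in
omit ht in
theorem IsAdmissible.continuousOn_sub (h : IsAdmissible T x α γ ℓ β₀ β₁) (k : Fin m) :
    ContinuousOn (fun q : 𝕜 × ℝ => γ q.1 q.2 - x k q.1) (T ×ˢ Icc (0 : ℝ) 1) :=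
  h.family.cont.sub (continuousOn_x hx k _)

omit [NormedAlgebra 𝕜 ℂ] in
include hT ht in
theorem exists_ball_of_eventually {s₀ : ℝ} {P : 𝕜 × ℝ → Prop} (hP : ∀ᶠ q in 𝓝 (t, s₀), P q) :
    ∃ ε > 0, ∀ q ∈ Metric.ball t ε ×ˢ Metric.ball s₀ ε, q.1 ∈ T ∧ P q := by
  have h2 : ∀ᶠ q : 𝕜 × ℝ in 𝓝 (t, s₀), q.1 ∈ T :=
    continuous_fst.continuousAt.eventually (hT.mem_nhds ht)
  obtain ⟨ε, hε, hb⟩ := Metric.eventually_nhds_iff_ball.1 (h2.and hP)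
  exact ⟨ε, hε, by rw [ball_prod_same]; exact hb⟩

include hT hx ht in
/-- Bound on one factor of the weight near a point where the curve is away from `xₖ`. -/
theorem IsAdmissible.norm_factor_le_of_ne (h : IsAdmissible T x α γ ℓ β₀ β₁) {s₀ : ℝ}
    (hs₀ : s₀ ∈ Icc (0 : ℝ) 1) {k : Fin m} (hk : γ t s₀ ≠ x k t) :
    ∃ C, ∀ᶠ q in 𝓝 (t, s₀), q.2 ∈ Ioo (0 : ℝ) 1 →
      ‖Complex.exp (α k * ℓ k q.1 q.2)‖ ≤ C := by
  have hc := sub_ne_zero.2 hk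
  have hcont := h.continuousOn_sub hx k
  have h1 := (hcont (t, s₀) ⟨ht, hs₀⟩).eventually
    (Metric.closedBall_mem_nhds _ (half_pos (norm_pos_iff.2 hc)))
  rw [eventually_nhdsWithin_iff] at h1
  obtain ⟨ε, hε, hb⟩ := exists_ball_of_eventually hT ht h1
  have hS : Metric.ball t ε ×ˢ (Metric.ball s₀ ε ∩ Ioo (0 : ℝ) 1) ⊆ T ×ˢ Ioo (0 : ℝ) 1 :=
    fun q hq => ⟨(hb q ⟨hq.1, hq.2.1⟩).1, hq.2.2⟩
  obtain ⟨C, hC⟩ := exists_norm_exp_mul_le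
    (S := Metric.ball t ε ×ˢ (Metric.ball s₀ ε ∩ Ioo (0 : ℝ) 1))
    ((convex_ball t ε).isPreconnected.prod
      ((convex_ball s₀ ε).inter (convex_Ioo _ _)).isPreconnected)
    (ℓ := fun q => ℓ k q.1 q.2) (u := fun q => γ q.1 q.2 - x k q.1) (ρ := fun _ => 1)
    ((h.log.cont k).mono hS) (hcont.mono (hS.trans (prod_mono le_rfl Ioo_subset_Icc_self)))
    continuousOn_const (fun _ _ => one_pos)
    (fun q hq => by
      rw [h.log.exp_eq k q.1 (hS hq).1 q.2 (hS hq).2]; simp)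
    hc (fun q hq => by
      have := (hb q ⟨hq.1, hq.2.1⟩).2 ⟨(hS hq).1, Ioo_subset_Icc_self (hS hq).2⟩
      rwa [dist_eq_norm] at this) (α k)
  refine ⟨C, ?_⟩
  filter_upwards [prod_mem_nhds (Metric.ball_mem_nhds t hε) (Metric.ball_mem_nhds s₀ hε)]
    with q hq hq2
  simpa using hC q ⟨hq.1, hq.2, hq2⟩

include hT hx ht in
/-- Bound on one factor of the weight near an end of the curve at `xₖ`. -/
theorem IsAdmissible.norm_factor_le_of_eq (h : IsAdmissible T x α γ ℓ β₀ β₁) {s₀ : ℝ}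
    (hs₀ : s₀ ∈ Icc (0 : ℝ) 1) {k : Fin m} (hk : γ t s₀ = x k t) :
    ∃ C, ∀ᶠ q in 𝓝 (t, s₀), q.2 ∈ Ioo (0 : ℝ) 1 →
      ‖Complex.exp (α k * ℓ k q.1 q.2)‖ ≤ C * |q.2 - s₀| ^ (α k).re := by
  obtain ⟨hv, hend, hs01⟩ := h.hit t ht s₀ hs₀ k hk
  have hcont := h.continuousOn_sub hx k
  -- `σ` is the sign of `s - s₀` inside the interval: `1` at the start, `-1` at the end. Then `(γ -
  -- x_k)/|s - s₀|` is close to the nonzero number `σ` times the tangent, as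
  -- `exists_norm_exp_mul_le` requires.
  obtain ⟨σ, hσ1, hσ⟩ : ∃ σ : ℝ, |σ| = 1 ∧
      ∀ s ∈ Ioo (0 : ℝ) 1, s - s₀ = σ * |s - s₀| ∧ 0 < |s - s₀| := by
    rcases hs01 with ⟨rfl, -⟩ | ⟨rfl, -⟩
    · exact ⟨1, abs_one, fun s hs => by
        rw [sub_zero, abs_of_pos hs.1]; exact ⟨(one_mul s).symm, hs.1⟩⟩
    · refine ⟨-1, by simp, fun s hs => ?_⟩
      have : s - 1 < 0 := sub_neg.2 hs.2
      rw [abs_of_neg this]; exact ⟨by ring, by linarith⟩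
  have hσ0 : (σ : ℂ) ≠ 0 := by
    rw [Complex.ofReal_ne_zero, ← abs_pos, hσ1]; exact one_pos
  have hc : (σ : ℂ) * deriv (γ t) s₀ ≠ 0 := mul_ne_zero hσ0 hv
  have hcn : ‖(σ : ℂ) * deriv (γ t) s₀‖ = ‖deriv (γ t) s₀‖ := by
    rw [norm_mul, Complex.norm_real, Real.norm_eq_abs, hσ1, one_mul]
  obtain ⟨ε, hε, hb⟩ := exists_ball_of_eventually hT ht
    (h.family.eventually_norm_sub_le hT ht hs₀ (half_pos (norm_pos_iff.2 hv)))
  have hS : Metric.ball t ε ×ˢ (Metric.ball s₀ ε ∩ Ioo (0 : ℝ) 1) ⊆ T ×ˢ Ioo (0 : ℝ) 1 :=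
    fun q hq => ⟨(hb q ⟨hq.1, hq.2.1⟩).1, hq.2.2⟩
  have hρc : Continuous fun q : 𝕜 × ℝ => |q.2 - s₀| := (continuous_snd.sub continuous_const).abs
  obtain ⟨C, hC⟩ := exists_norm_exp_mul_le
    (S := Metric.ball t ε ×ˢ (Metric.ball s₀ ε ∩ Ioo (0 : ℝ) 1))
    ((convex_ball t ε).isPreconnected.prod
      ((convex_ball s₀ ε).inter (convex_Ioo _ _)).isPreconnected)
    (ℓ := fun q => ℓ k q.1 q.2) (u := fun q => (γ q.1 q.2 - x k q.1) / (|q.2 - s₀| : ℝ))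
    (ρ := fun q => |q.2 - s₀|)
    ((h.log.cont k).mono hS)
    ((hcont.mono (hS.trans (prod_mono le_rfl Ioo_subset_Icc_self))).div
      (Complex.continuous_ofReal.comp hρc).continuousOn
      fun q hq => Complex.ofReal_ne_zero.2 (hσ q.2 hq.2.2).2.ne')
    hρc.continuousOn (fun q hq => (hσ q.2 hq.2.2).2)
    (fun q hq => by
      have h0 : ((|q.2 - s₀| : ℝ) : ℂ) ≠ 0 := Complex.ofReal_ne_zero.2 (hσ q.2 hq.2.2).2.ne'
      rw [h.log.exp_eq k q.1 (hS hq).1 q.2 (hS hq).2, mul_div_cancel₀ _ h0])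
    hc (fun q hq => by
      have hq0 := (hσ q.2 hq.2.2).2
      have h0 : ((|q.2 - s₀| : ℝ) : ℂ) ≠ 0 := Complex.ofReal_ne_zero.2 hq0.ne'
      have := (hb q ⟨hq.1, hq.2.1⟩).2 (Ioo_subset_Icc_self (hS hq).2)
      rw [hend q.1 (hS hq).1, (hσ q.2 hq.2.2).1, abs_mul, hσ1, one_mul, abs_abs] at this
      have e : (γ q.1 q.2 - x k q.1) / ((|q.2 - s₀| : ℝ) : ℂ) - σ * deriv (γ t) s₀
          = (γ q.1 q.2 - x k q.1 - ((σ * |q.2 - s₀| : ℝ) : ℂ) * deriv (γ t) s₀)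
            / ((|q.2 - s₀| : ℝ) : ℂ) := by
        rw [Complex.ofReal_mul]; field_simp
      rw [e, norm_div, Complex.norm_real, Real.norm_eq_abs, abs_abs, div_le_iff₀ hq0, hcn]
      exact this) (α k)
  refine ⟨C, ?_⟩
  filter_upwards [prod_mem_nhds (Metric.ball_mem_nhds t hε) (Metric.ball_mem_nhds s₀ hε)]
    with q hq hq2
  exact hC q ⟨hq.1, hq.2, hq2⟩

include hT hx ht in
-- As the points are distinct, at most one of them is met at `s₀`. Its factor gives an end power of
-- `endWeight`; all the other factors are bounded.
theorem IsAdmissible.exists_norm_branch_le_local (h : IsAdmissible T x α γ ℓ β₀ β₁)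
    (hinj : Function.Injective fun k => x k t) {s₀ : ℝ} (hs₀ : s₀ ∈ Icc (0 : ℝ) 1) :
    ∃ C, ∀ᶠ q in 𝓝 (t, s₀), q.2 ∈ Ioo (0 : ℝ) 1 →
      ‖branch α ℓ q.1 q.2‖ ≤ C * endWeight β₀ β₁ q.2 := by
  by_cases hk : ∃ k, γ t s₀ = x k t
  · obtain ⟨k, hk⟩ := hk
    obtain ⟨C₀, hC₀⟩ := h.norm_factor_le_of_eq hT hx ht hs₀ hk
    have hne : ∀ l, ∃ C, l ≠ k → ∀ᶠ q in 𝓝 (t, s₀), q.2 ∈ Ioo (0 : ℝ) 1 →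
        ‖Complex.exp (α l * ℓ l q.1 q.2)‖ ≤ C := by
      intro l
      by_cases hl : l = k
      · exact ⟨0, fun h => absurd hl h⟩
      · obtain ⟨C, hC⟩ := h.norm_factor_le_of_ne hT hx ht hs₀ (k := l)
          (fun h' => hl (hinj (h'.symm.trans hk)))
        exact ⟨C, fun _ => hC⟩
    choose C hC using hne
    have hall : ∀ᶠ q in 𝓝 (t, s₀), ∀ l, l ≠ k → q.2 ∈ Ioo (0 : ℝ) 1 →
        ‖Complex.exp (α l * ℓ l q.1 q.2)‖ ≤ C l :=
      eventually_all.2 fun l => by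
        by_cases hl : l = k
        · exact Eventually.of_forall fun q h => absurd hl h
        · exact (hC l hl).mono fun q hq _ => hq
    refine ⟨|C₀| * ∏ l ∈ Finset.univ.erase k, |C l|, ?_⟩
    filter_upwards [hC₀, hall] with q h1 h2 hq
    have hw : |q.2 - s₀| ^ (α k).re ≤ endWeight β₀ β₁ q.2 := by
      rcases (h.hit t ht s₀ hs₀ k hk).2.2 with ⟨rfl, hα⟩ | ⟨rfl, hα⟩
      · rw [hα, sub_zero, abs_of_pos hq.1]; exact rpow_le_endWeight hq
      · rw [hα, abs_sub_comm, abs_of_pos (sub_pos.2 hq.2)]; exact one_sub_rpow_le_endWeight hq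
    rw [branch, norm_prod, ← Finset.mul_prod_erase _ _ (Finset.mem_univ k), mul_right_comm]
    refine mul_le_mul ((h1 hq).trans ?_) ?_ (Finset.prod_nonneg fun _ _ => norm_nonneg _) ?_
    · exact mul_le_mul (le_abs_self _) hw (Real.rpow_nonneg (abs_nonneg _) _) (abs_nonneg _)
    · exact Finset.prod_le_prod (fun _ _ => norm_nonneg _) fun l hl =>
        (h2 l (Finset.mem_erase.1 hl).1 hq).trans (le_abs_self _)
    · exact mul_nonneg (abs_nonneg _) (zero_le_one.trans (one_le_endWeight hq))
  · have hk' : ∀ k, γ t s₀ ≠ x k t := fun k hk' => hk ⟨k, hk'⟩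
    choose C hC using fun k => h.norm_factor_le_of_ne hT hx ht hs₀ (hk' k)
    refine ⟨∏ l, |C l|, ?_⟩
    filter_upwards [eventually_all.2 hC] with q h2 hq
    rw [branch, norm_prod]
    refine (Finset.prod_le_prod (fun _ _ => norm_nonneg _) fun l _ =>
        (h2 l hq).trans (le_abs_self _)).trans ?_
    exact le_mul_of_one_le_right (Finset.prod_nonneg fun _ _ => abs_nonneg _)
      (one_le_endWeight hq)

include hT hx ht in
theorem IsAdmissible.exists_norm_branch_le (h : IsAdmissible T x α γ ℓ β₀ β₁)
    (hinj : Function.Injective fun k => x k t) :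
    ∃ C, ∀ᶠ τ in 𝓝 t, ∀ s ∈ Ioo (0 : ℝ) 1, ‖branch α ℓ τ s‖ ≤ C * endWeight β₀ β₁ s := by
  obtain ⟨C, hC⟩ := exists_uniform_of_local (t := t)
    (P := fun C τ s => s ∈ Ioo (0 : ℝ) 1 → ‖branch α ℓ τ s‖ ≤ C * endWeight β₀ β₁ s)
    (fun C C' τ s hCC h hs => (h hs).trans
      (mul_le_mul_of_nonneg_right hCC (zero_le_one.trans (one_le_endWeight hs))))
    (fun s₀ hs₀ => h.exists_norm_branch_le_local hT hx ht hinj hs₀)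
  exact ⟨C, hC.mono fun τ hτ s hs => hτ s (Ioo_subset_Icc_self hs) hs⟩

include hx' in
omit h ht in
theorem continuousOn_deriv_x (k : Fin m) (I : Set ℝ) :
    ContinuousOn (fun q : 𝕜 × ℝ => deriv (x k) q.1) (T ×ˢ I) :=
  (hx' k).comp continuousOn_fst fun _ hq => hq.1

include hT hx hx' ht in
/-- The velocity relative to `xₖ` is dominated by the distance to `xₖ`. -/
theorem IsAdmissible.exists_norm_deriv_sub_le (h : IsAdmissible T x α γ ℓ β₀ β₁) (k : Fin m) :
    ∃ C, ∀ᶠ τ in 𝓝 t, ∀ s ∈ Icc (0 : ℝ) 1,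
      ‖deriv (fun τ => γ τ s) τ - deriv (x k) τ‖ ≤ C * ‖γ τ s - x k τ‖ := by
  have hev : ∀ᶠ τ in 𝓝 t, τ ∈ T := hT.mem_nhds ht
  have hev2 : ∀ s₀ : ℝ, ∀ᶠ q : 𝕜 × ℝ in 𝓝 (t, s₀), q.1 ∈ T := fun s₀ =>
    continuous_fst.continuousAt.eventually hev
  obtain ⟨C, hC⟩ := exists_uniform_of_local (t := t)
    (P := fun C τ s => s ∈ Icc (0 : ℝ) 1 →
      ‖deriv (fun τ => γ τ s) τ - deriv (x k) τ‖ ≤ C * ‖γ τ s - x k τ‖)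
    (fun C C' τ s hCC h hs => (h hs).trans (mul_le_mul_of_nonneg_right hCC (norm_nonneg _)))
    (fun s₀ hs₀ => by
      by_cases hk : γ t s₀ = x k t
      -- The end stays at `x_k`, so the relative velocity vanishes there and is `O(|s - s₀|)`, while
      -- the nonzero tangent bounds the distance to `x_k` below by a multiple of `|s - s₀|`.
      · obtain ⟨hv, hend, -⟩ := h.hit t ht s₀ hs₀ k hk
        have hv' := norm_pos_iff.2 hv
        obtain ⟨M, hM⟩ := h.family.norm_deriv_t_sub_le hT ht
        refine ⟨|M| / (‖deriv (γ t) s₀‖ / 2), ?_⟩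
        filter_upwards [h.family.eventually_norm_sub_le hT ht hs₀ (half_pos hv'), hev2 s₀,
          continuous_fst.continuousAt.eventually hM] with q h1 hq h2 hs
        have e : deriv (fun τ => γ τ s₀) q.1 = deriv (x k) q.1 :=
          Filter.EventuallyEq.deriv_eq (by
            filter_upwards [hT.mem_nhds hq] with τ hτ using hend τ hτ)
        have h3 := h2 s₀ hs₀ q.2 hs
        have h4 := h1 hs
        rw [e] at h3
        rw [hend q.1 hq] at h4
        have h5 := norm_sub_norm_le (((q.2 - s₀ : ℝ) : ℂ) * deriv (γ t) s₀) (γ q.1 q.2 - x k q.1)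
        rw [norm_sub_rev (_ * _), norm_mul, Complex.norm_real, Real.norm_eq_abs] at h5
        have h6 : ‖deriv (γ t) s₀‖ / 2 * |q.2 - s₀| ≤ ‖γ q.1 q.2 - x k q.1‖ := by linarith
        refine (h3.trans (mul_le_mul_of_nonneg_right (le_abs_self M) (abs_nonneg _))).trans ?_
        rw [div_mul_eq_mul_div, le_div_iff₀ (half_pos hv'), mul_assoc, mul_comm |q.2 - s₀|]
        exact mul_le_mul_of_nonneg_left h6 (abs_nonneg M)
      · have hc := norm_pos_iff.2 (sub_ne_zero.2 hk)
        have hF := h.family.cont_t.sub (continuousOn_deriv_x hx' k (Icc 0 1))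
        have h1 := (hF (t, s₀) ⟨ht, hs₀⟩).norm.eventually (gt_mem_nhds (lt_add_one _))
        have h2 := (h.continuousOn_sub hx k (t, s₀) ⟨ht, hs₀⟩).norm.eventually
          (lt_mem_nhds (half_lt_self hc))
        rw [eventually_nhdsWithin_iff] at h1 h2
        refine ⟨(‖deriv (fun τ => γ τ s₀) t - deriv (x k) t‖ + 1) / (‖γ t s₀ - x k t‖ / 2), ?_⟩
        filter_upwards [h1, h2, hev2 s₀] with q h1 h2 hq hs
        rw [div_mul_eq_mul_div, le_div_iff₀ (half_pos hc)]
        exact mul_le_mul (h1 ⟨hq, hs⟩).le (h2 ⟨hq, hs⟩).le (half_pos hc).le (by positivity))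
  exact ⟨C, hC.mono fun τ hτ s hs => hτ s hs hs⟩

end Admissible

/-! ### Integrals over a curve family -/

section Integral

variable {𝕜 : Type*} [RCLike 𝕜] [NormedAlgebra 𝕜 ℂ] {T : Set 𝕜} {m : ℕ}
  {x : Fin m → 𝕜 → ℂ} {α : Fin m → ℂ} {γ : 𝕜 → ℝ → ℂ} {ℓ : Fin m → 𝕜 → ℝ → ℂ} {β₀ β₁ : ℝ}

omit [NormedAlgebra 𝕜 ℂ] in
theorem IsLogBranch.continuousOn_branch {I : Set ℝ} (h : IsLogBranch T I x γ ℓ) {t : 𝕜}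
    (ht : t ∈ T) : ContinuousOn (branch α ℓ t) I :=
  continuousOn_finsetProd _ fun k _ =>
    ((continuousOn_slice (h.cont k) ht).const_mul (α k)).cexp

theorem IsAdmissible.hasDerivAt_branch_t (hT : IsOpen T) (hx : ∀ k, DifferentiableOn 𝕜 (x k) T)
    (h : IsAdmissible T x α γ ℓ β₀ β₁) {t : 𝕜} (ht : t ∈ T) {s : ℝ} (hs : s ∈ Ioo (0 : ℝ) 1) :
    HasDerivAt (fun τ => branch α ℓ τ s) (branch α ℓ t s
      * ∑ k, α k * ((deriv (fun τ => γ τ s) t - deriv (x k) t) / (γ t s - x k t))) t := by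
  refine hasDerivAt_prod_exp (f := fun k τ => ℓ k τ s) α fun k => ?_
  have hev : ∀ᶠ τ in 𝓝 t, τ ∈ T := hT.mem_nhds ht
  refine hasDerivAt_of_exp_eq (f := fun τ => γ τ s - x k τ) ?_
    (hev.mono fun τ hτ => h.log.exp_eq k τ hτ s hs)
    ((h.family.hasDerivAt_t ht (Ioo_subset_Icc_self hs)).fun_sub
      ((hx k).differentiableAt (hT.mem_nhds ht)).hasDerivAt)
  have hc : ContinuousOn (fun τ => ℓ k τ s) T :=
    (h.log.cont k).comp (f := fun τ : 𝕜 => (τ, s)) (Continuous.prodMk_left s).continuousOn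
      fun τ hτ => ⟨hτ, hs⟩
  exact hc.continuousAt (hT.mem_nhds ht)

theorem IsAdmissible.hasDerivAt_branch_s (h : IsAdmissible T x α γ ℓ β₀ β₁) {t : 𝕜} (ht : t ∈ T)
    {s : ℝ} (hs : s ∈ Ioo (0 : ℝ) 1) :
    HasDerivAt (branch α ℓ t) (branch α ℓ t s
      * ∑ k, α k * (deriv (γ t) s / (γ t s - x k t))) s := by
  refine hasDerivAt_prod_exp (f := fun k => ℓ k t) α fun k => ?_
  refine hasDerivAt_of_exp_eq (f := fun s => γ t s - x k t)
    ((continuousOn_slice (h.log.cont k) ht).continuousAt (Ioo_mem_nhds hs.1 hs.2)) ?_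
    ((h.family.hasDerivAt_s ht (Ioo_subset_Icc_self hs)).sub_const _)
  filter_upwards [Ioo_mem_nhds hs.1 hs.2] with u hu using h.log.exp_eq k t ht u hu

theorem IsAdmissible.intervalIntegrable_of_norm_le (h : IsAdmissible T x α γ ℓ β₀ β₁)
    {f : ℝ → ℂ} (hf : ContinuousOn f (Ioo 0 1)) {C : ℝ}
    (hC : ∀ s ∈ Ioo (0 : ℝ) 1, ‖f s‖ ≤ C * endWeight β₀ β₁ s) :
    IntervalIntegrable f volume 0 1 := by
  have hg := ((intervalIntegrable_endWeight h.gt₀ h.gt₁).const_mul C)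
  rw [intervalIntegrable_iff_integrableOn_Ioo_of_le zero_le_one] at hg ⊢
  exact hg.mono' (hf.aestronglyMeasurable measurableSet_Ioo)
    ((ae_restrict_iff' measurableSet_Ioo).2 (Eventually.of_forall hC))

/-- The integrand of the linear form, for the polynomial `φ`. -/
noncomputable def integrand (α : Fin m → ℂ) (γ : 𝕜 → ℝ → ℂ) (ℓ : Fin m → 𝕜 → ℝ → ℂ) (φ : ℂ[X])
    (t : 𝕜) (s : ℝ) : ℂ :=
  φ.eval (γ t s) * branch α ℓ t s * deriv (γ t) s

/-- The derivative of the integrand with respect to the parameter. -/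
noncomputable def integrandDeriv (x : Fin m → 𝕜 → ℂ) (α : Fin m → ℂ) (γ : 𝕜 → ℝ → ℂ)
    (ℓ : Fin m → 𝕜 → ℝ → ℂ) (φ : ℂ[X]) (t : 𝕜) (s : ℝ) : ℂ :=
  branch α ℓ t s * ((derivative φ).eval (γ t s) * deriv (fun τ => γ τ s) t * deriv (γ t) s
    + φ.eval (γ t s) * deriv (fun τ => deriv (γ τ) s) t
    + φ.eval (γ t s) * deriv (γ t) s
      * ∑ k, α k * ((deriv (fun τ => γ τ s) t - deriv (x k) t) / (γ t s - x k t)))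

theorem IsAdmissible.continuousOn_eval (h : IsAdmissible T x α γ ℓ β₀ β₁) (φ : ℂ[X]) :
    ContinuousOn (fun q : 𝕜 × ℝ => φ.eval (γ q.1 q.2)) (T ×ˢ Icc (0 : ℝ) 1) :=
  φ.continuous.comp_continuousOn h.family.cont

theorem IsAdmissible.continuousOn_integrand (h : IsAdmissible T x α γ ℓ β₀ β₁) (φ : ℂ[X]) {t : 𝕜}
    (ht : t ∈ T) : ContinuousOn (integrand α γ ℓ φ t) (Ioo 0 1) :=
  (((continuousOn_slice (h.continuousOn_eval φ) ht).mono Ioo_subset_Icc_self).mul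
    (h.log.continuousOn_branch ht)).mul
      ((continuousOn_slice h.family.cont_s ht).mono Ioo_subset_Icc_self)

theorem IsAdmissible.continuousOn_integrandDeriv (h : IsAdmissible T x α γ ℓ β₀ β₁) (φ : ℂ[X])
    {t : 𝕜} (ht : t ∈ T) : ContinuousOn (integrandDeriv x α γ ℓ φ t) (Ioo 0 1) := by
  have c0 := fun P => (continuousOn_slice (h.continuousOn_eval P) ht).mono Ioo_subset_Icc_self
  have c1 := (continuousOn_slice h.family.cont ht).mono Ioo_subset_Icc_self
  have c2 := (continuousOn_slice h.family.cont_s ht).mono Ioo_subset_Icc_self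
  have c3 := (continuousOn_slice h.family.cont_t ht).mono Ioo_subset_Icc_self
  have c4 := (continuousOn_slice h.family.cont_ts ht).mono Ioo_subset_Icc_self
  refine (h.log.continuousOn_branch ht).mul (((((c0 _).mul c3).mul c2).add ((c0 _).mul c4)).add
    (((c0 _).mul c2).mul (continuousOn_finsetSum _ fun k _ => ?_)))
  exact (((c3.sub continuousOn_const).div (c1.sub continuousOn_const)
    fun s hs => h.log.ne ht hs k)).const_mul _

theorem IsAdmissible.hasDerivAt_integrand (hT : IsOpen T) (hx : ∀ k, DifferentiableOn 𝕜 (x k) T)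
    (h : IsAdmissible T x α γ ℓ β₀ β₁) (φ : ℂ[X]) {t : 𝕜} (ht : t ∈ T) {s : ℝ}
    (hs : s ∈ Ioo (0 : ℝ) 1) :
    HasDerivAt (fun τ => integrand α γ ℓ φ τ s) (integrandDeriv x α γ ℓ φ t s) t := by
  have hs' := Ioo_subset_Icc_self hs
  refine (((hasDerivAt_polynomial_comp φ (h.family.hasDerivAt_t ht hs')).fun_mul
    (h.hasDerivAt_branch_t hT hx ht hs)).fun_mul (h.family.hasDerivAt_ts ht hs')).congr_deriv ?_
  rw [integrandDeriv]; ring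

section Bounds

variable (hT : IsOpen T) (hx : ∀ k, DifferentiableOn 𝕜 (x k) T)
  (hx' : ∀ k, ContinuousOn (deriv (x k)) T) {t : 𝕜} (ht : t ∈ T)
  (hinj : Function.Injective fun k => x k t)

include hT hx ht hinj in
theorem IsAdmissible.exists_norm_integrand_le (h : IsAdmissible T x α γ ℓ β₀ β₁) (φ : ℂ[X]) :
    ∃ C, ∀ s ∈ Ioo (0 : ℝ) 1, ‖integrand α γ ℓ φ t s‖ ≤ C * endWeight β₀ β₁ s := by
  obtain ⟨C, hC⟩ := h.exists_norm_branch_le hT hx ht hinj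
  obtain ⟨C', hC'⟩ := exists_bound_of_continuousOn hT ht
    (F := fun t s => φ.eval (γ t s) * deriv (γ t) s)
    ((h.continuousOn_eval φ).mul h.family.cont_s)
  refine ⟨C * C', fun s hs => ?_⟩
  have h1 := hC.self_of_nhds s hs
  have h2 := hC'.self_of_nhds s (Ioo_subset_Icc_self hs)
  calc ‖integrand α γ ℓ φ t s‖ = ‖branch α ℓ t s‖ * ‖φ.eval (γ t s) * deriv (γ t) s‖ := by
        rw [integrand, ← norm_mul]; congr 1; ring
    _ ≤ C * endWeight β₀ β₁ s * C' := mul_le_mul h1 h2 (norm_nonneg _) ((norm_nonneg _).trans h1)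
    _ = _ := by ring

include hT hx ht hinj in
theorem IsAdmissible.intervalIntegrable_integrand (h : IsAdmissible T x α γ ℓ β₀ β₁) (φ : ℂ[X]) :
    IntervalIntegrable (integrand α γ ℓ φ t) volume 0 1 := by
  obtain ⟨C, hC⟩ := h.exists_norm_integrand_le hT hx ht hinj φ
  exact h.intervalIntegrable_of_norm_le (h.continuousOn_integrand φ ht) hC

include hT hx hx' ht hinj in
-- The quotients `(∂γ/∂t - ẋ_k)/(γ - x_k)` are bounded by `exists_norm_deriv_sub_le`, so a majorant
-- of the weight, locally uniform in the parameter, serves for the derivative too.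
theorem IsAdmissible.exists_norm_integrandDeriv_le (h : IsAdmissible T x α γ ℓ β₀ β₁) (φ : ℂ[X]) :
    ∃ C, ∀ᶠ τ in 𝓝 t, ∀ s ∈ Ioo (0 : ℝ) 1,
      ‖integrandDeriv x α γ ℓ φ τ s‖ ≤ C * endWeight β₀ β₁ s := by
  obtain ⟨C, hC⟩ := h.exists_norm_branch_le hT hx ht hinj
  obtain ⟨C₁, hC₁⟩ := exists_bound_of_continuousOn hT ht
    (F := fun t s => (derivative φ).eval (γ t s) * deriv (fun τ => γ τ s) t * deriv (γ t) s
      + φ.eval (γ t s) * deriv (fun τ => deriv (γ τ) s) t)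
    ((((h.continuousOn_eval _).mul h.family.cont_t).mul h.family.cont_s).add
      ((h.continuousOn_eval φ).mul h.family.cont_ts))
  obtain ⟨C₂, hC₂⟩ := exists_bound_of_continuousOn hT ht
    (F := fun t s => φ.eval (γ t s) * deriv (γ t) s)
    ((h.continuousOn_eval φ).mul h.family.cont_s)
  choose C₃ hC₃ using fun k => h.exists_norm_deriv_sub_le hT hx hx' ht k
  refine ⟨C * (C₁ + C₂ * ∑ k, ‖α k‖ * |C₃ k|), ?_⟩
  filter_upwards [hC, hC₁, hC₂, eventually_all.2 hC₃] with τ h0 h1 h2 h3 s hs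
  have hs' := Ioo_subset_Icc_self hs
  have b0 := h0 s hs
  have b1 := h1 s hs'
  have b2 := h2 s hs'
  have b3 : ‖∑ k, α k * ((deriv (fun τ => γ τ s) τ - deriv (x k) τ) / (γ τ s - x k τ))‖
      ≤ ∑ k, ‖α k‖ * |C₃ k| := by
    refine norm_sum_le_of_le _ fun k _ => ?_
    rw [norm_mul, norm_div]
    refine mul_le_mul_of_nonneg_left (div_le_of_le_mul₀ (norm_nonneg _) (abs_nonneg _) ?_)
      (norm_nonneg _)
    exact (h3 k s hs').trans (mul_le_mul_of_nonneg_right (le_abs_self _) (norm_nonneg _))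
  rw [integrandDeriv, norm_mul, mul_right_comm C]
  refine mul_le_mul b0 ((norm_add_le _ _).trans (add_le_add b1 ?_)) (norm_nonneg _)
    ((norm_nonneg _).trans b0)
  rw [norm_mul]
  exact mul_le_mul b2 b3 (norm_nonneg _) ((norm_nonneg _).trans b2)

include hT hx hx' ht hinj in
theorem IsAdmissible.hasDerivAt_integral (h : IsAdmissible T x α γ ℓ β₀ β₁)
    (hinj' : ∀ t ∈ T, Function.Injective fun k => x k t) (φ : ℂ[X]) :
    IntervalIntegrable (integrandDeriv x α γ ℓ φ t) volume 0 1 ∧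
    HasDerivAt (fun τ => ∫ s in (0 : ℝ)..1, integrand α γ ℓ φ τ s)
      (∫ s in (0 : ℝ)..1, integrandDeriv x α γ ℓ φ t s) t := by
  obtain ⟨C, hC⟩ := h.exists_norm_integrandDeriv_le hT hx hx' ht hinj φ
  have hev : ∀ᶠ τ in 𝓝 t, τ ∈ T := hT.mem_nhds ht
  have hae : ∀ {P : ℝ → Prop}, (∀ s ∈ Ioo (0 : ℝ) 1, P s) →
      ∀ᵐ s ∂volume, s ∈ uIoc (0 : ℝ) 1 → P s := by
    intro P hP
    have h1 : ∀ᵐ s : ℝ ∂volume, s ≠ 1 := by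
      simp [ae_iff]
    filter_upwards [h1] with s hs1 hs
    rw [uIoc_of_le zero_le_one] at hs
    exact hP s ⟨hs.1, lt_of_le_of_ne hs.2 hs1⟩
  have hint' := h.intervalIntegrable_of_norm_le (h.continuousOn_integrandDeriv φ ht)
    hC.self_of_nhds
  refine intervalIntegral.hasDerivAt_integral_of_dominated_loc_of_deriv_le
    (s := {τ | (∀ s ∈ Ioo (0 : ℝ) 1,
      ‖integrandDeriv x α γ ℓ φ τ s‖ ≤ C * endWeight β₀ β₁ s) ∧ τ ∈ T})
    (hC.and hev)
    (hev.mono fun τ hτ =>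
      (intervalIntegrable_iff.1
        (h.intervalIntegrable_integrand hT hx hτ (hinj' τ hτ) φ)).aestronglyMeasurable)
    (h.intervalIntegrable_integrand hT hx ht hinj φ)
    (intervalIntegrable_iff.1 hint').aestronglyMeasurable
    (hae fun s hs τ hτ => hτ.1 s hs)
    ((intervalIntegrable_endWeight h.gt₀ h.gt₁).const_mul C)
    (hae fun s hs τ hτ => h.hasDerivAt_integrand hT hx φ hτ.2 hs)

end Bounds

end Integral

/-! ### Total derivatives along the curves -/

section Total

variable {𝕜 : Type*} [RCLike 𝕜] [NormedAlgebra 𝕜 ℂ] {T : Set 𝕜} {m : ℕ}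
  {x : Fin m → 𝕜 → ℂ} {α : Fin m → ℂ} {γ : 𝕜 → ℝ → ℂ} {ℓ : Fin m → 𝕜 → ℝ → ℂ} {β₀ β₁ : ℝ}

/-- Multiples of the weight by functions vanishing at the points `xₖ` have equal limits at both
ends of the curves. -/
def HasEqualEnds (T : Set 𝕜) (x : Fin m → 𝕜 → ℂ) (α : Fin m → ℂ) (γ : 𝕜 → ℝ → ℂ)
    (ℓ : Fin m → 𝕜 → ℝ → ℂ) : Prop :=
  ∀ t ∈ T, ∀ R : ℝ → ℂ, ContinuousOn R (Icc 0 1) → ((∀ τ ∈ T, γ τ 0 = γ τ 1) → R 0 = R 1) →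
    (∀ k, ∃ C, ∀ s ∈ Ioo (0 : ℝ) 1, ‖R s‖ ≤ C * ‖γ t s - x k t‖) →
    ∃ c, Tendsto (fun s => R s * branch α ℓ t s) (𝓝[>] 0) (𝓝 c) ∧
      Tendsto (fun s => R s * branch α ℓ t s) (𝓝[<] 1) (𝓝 c)

theorem IsClosedContour.hasEqualEnds (h : IsClosedContour T x α γ ℓ) :
    HasEqualEnds T x α γ ℓ := by
  intro t ht R hR hR01 _
  have hc : ContinuousOn (fun s => R s * branch α ℓ t s) (Icc 0 1) :=
    hR.mul (h.log.continuousOn_branch ht)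
  refine ⟨R 0 * branch α ℓ t 0, ?_, ?_⟩
  · have := (hc 0 ⟨le_rfl, zero_le_one⟩).mono Ioo_subset_Icc_self
    rwa [ContinuousWithinAt, nhdsWithin_Ioo_eq_nhdsGT zero_lt_one] at this
  · have := (hc 1 ⟨zero_le_one, le_rfl⟩).mono Ioo_subset_Icc_self
    rwa [ContinuousWithinAt, nhdsWithin_Ioo_eq_nhdsLT zero_lt_one, ← hR01 h.closed,
      ← h.branch_closed t ht] at this

theorem IsCurveFamily.exists_norm_sub_le (h : IsCurveFamily T γ) (hT : IsOpen T) {t : 𝕜}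
    (ht : t ∈ T) : ∃ C, ∀ s₁ ∈ Icc (0 : ℝ) 1, ∀ s₂ ∈ Icc (0 : ℝ) 1,
      ‖γ t s₂ - γ t s₁‖ ≤ C * |s₂ - s₁| := by
  obtain ⟨C, hC⟩ := exists_bound_of_continuousOn hT ht (F := fun t s => deriv (γ t) s) h.cont_s
  exact ⟨C, fun s₁ hs₁ s₂ hs₂ => Convex.norm_image_sub_le_of_norm_deriv_le (𝕜 := ℝ)
    (fun s hs => h.diff_s t ht s hs) (fun s hs => hC.self_of_nhds s hs) (convex_Icc 0 1) hs₁ hs₂⟩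

/-- Both limits are zero: `R` is of the order of the distance to the end parameter, and this factor
raises an exponent above `-1` to a positive one. -/
theorem IsJoiningArc.hasEqualEnds (hT : IsOpen T) (hx : ∀ k, DifferentiableOn 𝕜 (x k) T)
    (hinj : ∀ t ∈ T, Function.Injective fun k => x k t) (h : IsJoiningArc T x α γ ℓ) :
    HasEqualEnds T x α γ ℓ := by
  intro t ht R _ _ hR
  obtain ⟨β₀, β₁, ha⟩ := h.isAdmissible hinj
  obtain ⟨B, hB⟩ := ha.exists_norm_branch_le hT hx ht (hinj t ht)
  obtain ⟨M, hM⟩ := h.family.exists_norm_sub_le hT ht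
  obtain ⟨i, -, hi⟩ := h.source
  obtain ⟨j, -, hj⟩ := h.target
  obtain ⟨C₀, hC₀⟩ := hR i
  obtain ⟨C₁, hC₁⟩ := hR j
  have bound : ∀ {C e s : ℝ}, s ∈ Ioo (0 : ℝ) 1 → e ∈ Icc (0 : ℝ) 1 →
      ‖R s‖ ≤ C * ‖γ t s - γ t e‖ →
      ‖R s * branch α ℓ t s‖ ≤ |C| * M * B * (|s - e| * endWeight β₀ β₁ s) := by
    intro C e s hs he hRs
    have h1 := hB.self_of_nhds s hs
    have h2 := hM e he s (Ioo_subset_Icc_self hs)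
    rw [norm_mul]
    have h3 : ‖R s‖ ≤ |C| * (M * |s - e|) :=
      (hRs.trans (mul_le_mul_of_nonneg_right (le_abs_self C) (norm_nonneg _))).trans
        (mul_le_mul_of_nonneg_left h2 (abs_nonneg C))
    calc _ ≤ |C| * (M * |s - e|) * (B * endWeight β₀ β₁ s) :=
          mul_le_mul h3 h1 (norm_nonneg _) ((norm_nonneg _).trans h3)
      _ = _ := by ring
  refine ⟨0, ?_, ?_⟩
  · refine squeeze_zero_norm' ?_ (by
      simpa using (tendsto_mul_endWeight_zero (β₁ := β₁) ha.gt₀).const_mul (|C₀| * M * B))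
    filter_upwards [Ioo_mem_nhdsGT (zero_lt_one (α := ℝ))] with s hs
    have := bound (C := C₀) (e := 0) hs ⟨le_rfl, zero_le_one⟩ (by rw [hi t ht]; exact hC₀ s hs)
    rwa [sub_zero, abs_of_pos hs.1] at this
  · refine squeeze_zero_norm' ?_ (by
      simpa using (tendsto_mul_endWeight_one (β₀ := β₀) ha.gt₁).const_mul (|C₁| * M * B))
    filter_upwards [Ioo_mem_nhdsLT (zero_lt_one (α := ℝ))] with s hs
    have := bound (C := C₁) (e := 1) hs ⟨zero_le_one, le_rfl⟩ (by rw [hj t ht]; exact hC₁ s hs)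
    rwa [abs_sub_comm, abs_of_pos (sub_pos.2 hs.2)] at this

/-- `G` is the derivative of `R` times the weight on the open interval, and this product has equal
limits at the two ends. -/
theorem IsAdmissible.integral_total_deriv (h : IsAdmissible T x α γ ℓ β₀ β₁)
    (he : HasEqualEnds T x α γ ℓ) {t : 𝕜} (ht : t ∈ T) {R R' : ℝ → ℂ}
    (hR : ContinuousOn R (Icc 0 1)) (hR01 : (∀ τ ∈ T, γ τ 0 = γ τ 1) → R 0 = R 1)
    (hRx : ∀ k, ∃ C, ∀ s ∈ Ioo (0 : ℝ) 1, ‖R s‖ ≤ C * ‖γ t s - x k t‖)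
    (hR' : ∀ s ∈ Ioo (0 : ℝ) 1, HasDerivAt R (R' s) s) {G : ℝ → ℂ}
    (hG : IntervalIntegrable G volume 0 1)
    (hGR : ∀ s ∈ Ioo (0 : ℝ) 1, G s = branch α ℓ t s
      * (R' s + R s * ∑ k, α k * (deriv (γ t) s / (γ t s - x k t)))) :
    ∫ s in (0 : ℝ)..1, G s = 0 := by
  obtain ⟨c, hc0, hc1⟩ := he t ht R hR hR01 hRx
  rw [intervalIntegral.integral_eq_sub_of_hasDerivAt_of_tendsto zero_lt_one
    (fun s hs => ((hR' s hs).fun_mul (h.hasDerivAt_branch_s ht hs)).congr_deriv ?_) hG hc0 hc1,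
    sub_self]
  rw [hGR s hs]; ring

theorem eval_two_mul_V_eq (x α : Fin m → ℂ) {z : ℂ} (hz : ∀ k, z - x k ≠ 0) :
    (2 * V x α).eval z = (W x).eval z * ∑ k, α k / (z - x k) := by
  rw [two_mul_V, eval_finsetSum, Finset.mul_sum]
  refine Finset.sum_congr rfl fun k _ => ?_
  rw [← X_sub_C_mul_cofactor x k]
  simp only [eval_mul, eval_C, eval_sub, eval_X]
  have := hz k
  field_simp

theorem eval_W_ne_zero {x : Fin m → ℂ} {z : ℂ} (hz : ∀ k, z - x k ≠ 0) : (W x).eval z ≠ 0 := by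
  rw [W, eval_prod]
  exact Finset.prod_ne_zero_iff.2 fun k _ => by simpa using hz k

variable (hT : IsOpen T) (hx : ∀ k, DifferentiableOn 𝕜 (x k) T)
  (hx' : ∀ k, ContinuousOn (deriv (x k)) T) (hinj : ∀ t ∈ T, Function.Injective fun k => x k t)
  {t : 𝕜} (ht : t ∈ T)

include hT hx hinj ht in
-- The integrand is the total derivative of `φ W` times the weight, because `2V/W` is the
-- logarithmic derivative of the weight; the factor `W` supplies the vanishing at the points `x_k`.
theorem IsAdmissible.integral_pearson (h : IsAdmissible T x α γ ℓ β₀ β₁)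
    (he : HasEqualEnds T x α γ ℓ) (φ : ℂ[X]) :
    ∫ s in (0 : ℝ)..1, integrand α γ ℓ (derivative (φ * W fun k => x k t)
      + 2 * V (fun k => x k t) α * φ) t s = 0 := by
  refine h.integral_total_deriv he ht (R := fun s => (φ * W fun k => x k t).eval (γ t s))
    (R' := fun s => (derivative (φ * W fun k => x k t)).eval (γ t s) * deriv (γ t) s)
    (continuousOn_slice (h.continuousOn_eval _) ht)
    (fun h01 => by simp only [h01 t ht]) (fun k => ?_)
    (fun s hs => hasDerivAt_polynomial_comp _ (h.family.hasDerivAt_s ht (Ioo_subset_Icc_self hs)))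
    (h.intervalIntegrable_integrand hT hx ht (hinj t ht) _) (fun s hs => ?_)
  · obtain ⟨C, hC⟩ := exists_bound_of_continuousOn hT ht
      (F := fun t' s => (φ * cofactor (fun k => x k t) k).eval (γ t' s)) (h.continuousOn_eval _)
    refine ⟨C, fun s hs => ?_⟩
    rw [← X_sub_C_mul_cofactor (fun k => x k t) k, mul_left_comm, eval_mul, norm_mul, mul_comm]
    simp only [eval_sub, eval_X, eval_C]
    exact mul_le_mul_of_nonneg_right (hC.self_of_nhds s (Ioo_subset_Icc_self hs)) (norm_nonneg _)
  · rw [integrand, eval_add, eval_mul (p := 2 * _), eval_two_mul_V_eq (fun k => x k t) α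
      fun k => h.log.ne ht hs k]
    have e : ∑ k, α k * (deriv (γ t) s / (γ t s - x k t))
        = deriv (γ t) s * ∑ k, α k / (γ t s - x k t) := by
      rw [Finset.mul_sum]; exact Finset.sum_congr rfl fun k _ => by ring
    rw [e, eval_mul]; ring

include hT hx hx' hinj ht in
-- The two integrands differ by the `s`-derivative of `φ(γ) (∂γ/∂t - D(γ))` times the weight: only
-- the velocity relative to the field `D` matters, and changing it reparametrizes or deforms the
-- curve. Since `D` interpolates the `ẋ_k`, this relative velocity is dominated by the distance to
-- each `x_k`.
theorem IsAdmissible.hasDerivAt_integral_integrand (h : IsAdmissible T x α γ ℓ β₀ β₁)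
    (he : HasEqualEnds T x α γ ℓ) {D E : ℂ[X]} (hD : ∀ k, D.eval (x k t) = deriv (x k) t)
    (hE : (W fun k => x k t) * E = 2 * V (fun k => x k t) α * D
      - ∑ k, C (α k * deriv (x k) t) * cofactor (fun k => x k t) k) (φ : ℂ[X]) :
    HasDerivAt (fun τ => ∫ s in (0 : ℝ)..1, integrand α γ ℓ φ τ s)
      (∫ s in (0 : ℝ)..1, integrand α γ ℓ (derivative (φ * D) + φ * E) t s) t := by
  obtain ⟨hint, hder⟩ := h.hasDerivAt_integral hT hx hx' ht (hinj t ht) hinj φ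
  have hint2 := h.intervalIntegrable_integrand hT hx ht (hinj t ht) (derivative (φ * D) + φ * E)
  refine hder.congr_deriv (sub_eq_zero.1 ?_)
  rw [← intervalIntegral.integral_sub hint hint2]
  refine h.integral_total_deriv he ht
    (R := fun s => φ.eval (γ t s) * (deriv (fun τ => γ τ s) t - D.eval (γ t s)))
    (R' := fun s => (derivative φ).eval (γ t s) * deriv (γ t) s
        * (deriv (fun τ => γ τ s) t - D.eval (γ t s))
      + φ.eval (γ t s) * (deriv (fun τ => deriv (γ τ) s) t
        - (derivative D).eval (γ t s) * deriv (γ t) s))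
    ((continuousOn_slice (h.continuousOn_eval φ) ht).mul
      ((continuousOn_slice h.family.cont_t ht).sub (continuousOn_slice (h.continuousOn_eval D) ht)))
    (fun h01 => ?_) (fun k => ?_) (fun s hs => ?_) (hint.sub hint2) (fun s hs => ?_)
  · have e : deriv (fun τ => γ τ 0) t = deriv (fun τ => γ τ 1) t :=
      Filter.EventuallyEq.deriv_eq (by filter_upwards [hT.mem_nhds ht] with τ hτ using h01 τ hτ)
    simp only [e, h01 t ht]
  · obtain ⟨C₀, hC₀⟩ := exists_bound_of_continuousOn hT ht
      (F := fun t s => φ.eval (γ t s)) (h.continuousOn_eval φ)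
    obtain ⟨C₁, hC₁⟩ := exists_bound_of_continuousOn hT ht
      (F := fun t' s => (dd (x k t) D).eval (γ t' s)) (h.continuousOn_eval _)
    obtain ⟨C₂, hC₂⟩ := h.exists_norm_deriv_sub_le hT hx hx' ht k
    refine ⟨C₀ * (C₂ + C₁), fun s hs => ?_⟩
    have hs' := Ioo_subset_Icc_self hs
    have b0 := hC₀.self_of_nhds s hs'
    have b1 := hC₁.self_of_nhds s hs'
    have b2 := hC₂.self_of_nhds s hs'
    have e := congrArg (eval (γ t s)) (X_sub_C_mul_dd (x k t) D)
    simp only [eval_mul, eval_sub, eval_X, eval_C, hD] at e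
    have e2 : deriv (fun τ => γ τ s) t - D.eval (γ t s) = (deriv (fun τ => γ τ s) t
        - deriv (x k) t) - (γ t s - x k t) * (dd (x k t) D).eval (γ t s) := by rw [e]; ring
    rw [norm_mul, e2, mul_assoc]
    refine mul_le_mul b0 ((norm_sub_le _ _).trans ?_) (norm_nonneg _) ((norm_nonneg _).trans b0)
    rw [add_mul, norm_mul, mul_comm ‖γ t s - x k t‖]
    exact add_le_add b2 (mul_le_mul_of_nonneg_right b1 (norm_nonneg _))
  · have hs' := Ioo_subset_Icc_self hs
    have hγ := h.family.hasDerivAt_s ht hs'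
    exact (hasDerivAt_polynomial_comp φ hγ).fun_mul
      ((h.family.hasDerivAt_deriv_t hT ht hs).fun_sub (hasDerivAt_polynomial_comp D hγ))
  · have hne := fun k => h.log.ne ht hs k
    have hWne := eval_W_ne_zero (x := fun k => x k t) hne
    -- Away from the points, `hE` says that `E` is the logarithmic derivative of the weight along
    -- the field `D`.
    have e1 : E.eval (γ t s) = ∑ k, α k * ((D.eval (γ t s) - deriv (x k) t) / (γ t s - x k t)) := by
      apply mul_left_cancel₀ hWne
      have := congrArg (eval (γ t s)) hE
      rw [eval_mul, eval_sub, eval_mul, eval_two_mul_V_eq (fun k => x k t) α hne,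
        eval_finsetSum] at this
      rw [this, Finset.mul_sum, Finset.mul_sum, Finset.sum_mul, ← Finset.sum_sub_distrib]
      refine Finset.sum_congr rfl fun k _ => ?_
      rw [← X_sub_C_mul_cofactor (fun k => x k t) k]
      simp only [eval_mul, eval_C, eval_sub, eval_X]
      have := hne k
      field_simp
    have e2 : deriv (γ t) s * E.eval (γ t s)
        = deriv (γ t) s
          * ∑ k, α k * ((deriv (fun τ => γ τ s) t - deriv (x k) t) / (γ t s - x k t))
        - (deriv (fun τ => γ τ s) t - D.eval (γ t s))
          * ∑ k, α k * (deriv (γ t) s / (γ t s - x k t)) := by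
      rw [e1, Finset.mul_sum, Finset.mul_sum, Finset.mul_sum, ← Finset.sum_sub_distrib]
      exact Finset.sum_congr rfl fun k _ => by ring
    simp only [integrand, integrandDeriv, derivative_mul, eval_add, eval_mul]
    linear_combination (-φ.eval (γ t s) * branch α ℓ t s) * e2

end Total

/-! ### The moments -/

section Moments

variable {𝕜 : Type*} [RCLike 𝕜] [NormedAlgebra 𝕜 ℂ] {T : Set 𝕜} {m r : ℕ}
  {x : Fin m → 𝕜 → ℂ} {α : Fin m → ℂ} {A : Fin r → ℂ} {γ : Fin r → 𝕜 → ℝ → ℂ}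
  {ℓ : Fin r → Fin m → 𝕜 → ℝ → ℂ} (hT : IsOpen T) (hx : ∀ k, DifferentiableOn 𝕜 (x k) T)
  (hx' : ∀ k, ContinuousOn (deriv (x k)) T) (hinj : ∀ t ∈ T, Function.Injective fun k => x k t)
  (harc : ∀ j, IsJoiningArc T x α (γ j) (ℓ j) ∨ IsClosedContour T x α (γ j) (ℓ j))
  {t : 𝕜} (ht : t ∈ T)

include hT hx hinj harc in
theorem isAdmissible_and_hasEqualEnds (j : Fin r) :
    (∃ β₀ β₁, IsAdmissible T x α (γ j) (ℓ j) β₀ β₁) ∧ HasEqualEnds T x α (γ j) (ℓ j) := by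
  rcases harc j with h | h
  · exact ⟨h.isAdmissible hinj, h.hasEqualEnds hT hx hinj⟩
  · exact ⟨⟨0, 0, h.isAdmissible⟩, h.hasEqualEnds⟩

include hT hx hinj harc ht in
theorem linMap_moment (φ : ℂ[X]) : linMap (moment α A γ ℓ t) φ
    = ∑ j, A j * ∫ s in (0 : ℝ)..1, integrand α (γ j) (ℓ j) φ t s := by
  have hint : ∀ (j : Fin r) (φ : ℂ[X]),
      IntervalIntegrable (integrand α (γ j) (ℓ j) φ t) volume 0 1 := by
    intro j φ
    obtain ⟨⟨β₀, β₁, h⟩, -⟩ := isAdmissible_and_hasEqualEnds hT hx hinj harc j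
    exact h.intervalIntegrable_integrand hT hx ht (hinj t ht) φ
  induction φ using Polynomial.induction_on' with
  | add p q hp hq =>
    rw [map_add, hp, hq, ← Finset.sum_add_distrib]
    refine Finset.sum_congr rfl fun j _ => ?_
    rw [← mul_add, ← intervalIntegral.integral_add (hint j p) (hint j q)]
    congr 2; funext s
    simp only [integrand, eval_add]; ring
  | monomial n a =>
    rw [linMap_monomial, moment, Finset.mul_sum]
    refine Finset.sum_congr rfl fun j _ => ?_
    rw [mul_left_comm, ← intervalIntegral.integral_const_mul]
    congr 2; funext s
    simp only [integrand, eval_monomial]; ring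

include hT hx hinj harc ht in
theorem isPearson_moment : IsPearson (fun k => x k t) α (moment α A γ ℓ t) := by
  intro φ
  rw [linMap_moment hT hx hinj harc ht]
  refine Finset.sum_eq_zero fun j _ => ?_
  obtain ⟨⟨β₀, β₁, h⟩, he⟩ := isAdmissible_and_hasEqualEnds hT hx hinj harc j
  rw [h.integral_pearson hT hx hinj ht he, mul_zero]

include hT hx hx' hinj harc ht in
/-- The derivatives of the moments, and the linear form they define. -/
theorem exists_hasDerivAt_moment : ∃ μ' : ℕ → ℂ,
    (∀ n, HasDerivAt (fun τ => moment α A γ ℓ τ n) (μ' n) t) ∧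
    ∀ φ, linMap μ' φ = ∑ k, (-((U (fun k => x k t) α (moment α A γ ℓ t)).eval (x k t)
        * φ.eval (x k t)) - (2 * V (fun k => x k t) α).eval (x k t)
        * (polyPart (moment α A γ ℓ t) φ).eval (x k t))
      * deriv (x k) t / (derivative (W fun k => x k t)).eval (x k t) := by
  set X₀ : Fin m → ℂ := fun k => x k t with hX₀
  have hne : ∀ k, (derivative (W X₀)).eval (X₀ k) ≠ 0 := fun k => by
    rw [eval_derivative_W]; exact eval_cofactor_ne_zero (hinj t ht) k
  set d : Fin m → ℂ := fun k => deriv (x k) t / (derivative (W X₀)).eval (X₀ k) with hd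
  -- `D` is the Lagrange interpolation of the velocities. The polynomial `E` solves `hE` because
  -- `2V(x_k) = α_k W'(x_k)`, whence `2V(x_k) d_k = α_k ẋ_k`.
  set D : ℂ[X] := ∑ k, C (d k) * cofactor X₀ k with hDdef
  set E : ℂ[X] := ∑ k, C (d k) * dd (X₀ k) (2 * V X₀ α) with hEdef
  have hD : ∀ k, D.eval (x k t) = deriv (x k) t := by
    intro k
    rw [hDdef, eval_finsetSum, Finset.sum_eq_single k]
    · have h1 := hne k
      rw [eval_mul, eval_C, hd]
      rw [eval_derivative_W] at h1
      simp only [eval_derivative_W]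
      exact div_mul_cancel₀ _ h1
    · intro l _ hl
      rw [eval_mul, eval_cofactor_of_ne X₀ hl.symm, mul_zero]
    · simp
  have hE : W X₀ * E = 2 * V X₀ α * D - ∑ k, C (α k * deriv (x k) t) * cofactor X₀ k := by
    rw [hEdef, hDdef, Finset.mul_sum, Finset.mul_sum, ← Finset.sum_sub_distrib]
    refine Finset.sum_congr rfl fun k _ => ?_
    have h1 := X_sub_C_mul_dd (X₀ k) (2 * V X₀ α)
    have h2 : C ((2 * V X₀ α).eval (X₀ k)) * C (d k) = C (α k * deriv (x k) t) := by
      have h3 := hne k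
      rw [eval_two_mul_V, ← C_mul, hd, ← eval_derivative_W]
      congr 1
      field_simp
    rw [← X_sub_C_mul_cofactor X₀ k, ← h2]
    linear_combination (cofactor X₀ k * C (d k)) * h1
  set μ := moment α A γ ℓ t with hμ
  refine ⟨fun n => linMap μ (derivative (X ^ n * D) + X ^ n * E), fun n => ?_, fun φ => ?_⟩
  · change HasDerivAt _ (linMap (moment α A γ ℓ t) (derivative (X ^ n * D) + X ^ n * E)) t
    rw [linMap_moment hT hx hinj harc ht]
    have e : ∀ τ, moment α A γ ℓ τ n
        = ∑ j, A j * ∫ s in (0 : ℝ)..1, integrand α (γ j) (ℓ j) (X ^ n) τ s := fun τ => by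
      simp only [moment, integrand, eval_pow, eval_X]
    simp only [e]
    refine HasDerivAt.fun_sum fun j _ => HasDerivAt.const_mul _ ?_
    obtain ⟨⟨β₀, β₁, h⟩, he⟩ := isAdmissible_and_hasEqualEnds hT hx hinj harc j
    exact h.hasDerivAt_integral_integrand hT hx hx' hinj ht he hD hE _
  · have h1 : linMap (fun n => linMap μ (derivative (X ^ n * D) + X ^ n * E)) φ
        = linMap μ (derivative (φ * D) + φ * E) := by
      induction φ using Polynomial.induction_on' with
      | add p q hp hq =>
        rw [map_add, hp, hq, ← map_add]; congr 1
        rw [add_mul, add_mul, derivative_add]; ring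
      | monomial n a =>
        rw [linMap_monomial, ← linMap_C_mul]; congr 1
        rw [← C_mul_X_pow_eq_monomial, mul_assoc, derivative_C_mul]; ring
    have h2 : derivative (φ * D) + φ * E = ∑ k, C (d k)
        * (derivative (φ * cofactor X₀ k) + φ * dd (X₀ k) (2 * V X₀ α)) := by
      rw [hDdef, hEdef, Finset.mul_sum, Finset.mul_sum, derivative_sum, ← Finset.sum_add_distrib]
      refine Finset.sum_congr rfl fun k _ => ?_
      rw [mul_left_comm φ (C (d k)), derivative_C_mul]; ring
    have hP : IsPearson X₀ α μ := isPearson_moment hT hx hinj harc ht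
    rw [h1, h2, map_sum]
    refine Finset.sum_congr rfl fun k _ => ?_
    rw [linMap_C_mul, hP.linMap_shift, hd]
    ring

end Moments

end Toda

/-! ### The Toda equations -/

theorem theorem2 {𝕜 : Type*} [RCLike 𝕜] [NormedAlgebra 𝕜 ℂ]
    -- the parameter set
    (T : Set 𝕜) (hT : IsOpen T)
    -- the points `xₖ(t)` and the exponents
    (m : ℕ) (hm : 2 ≤ m) (x : Fin m → 𝕜 → ℂ) (α : Fin m → ℂ)
    (hx_inj : ∀ t ∈ T, Function.Injective fun k => x k t)
    (hx_diff : ∀ k, DifferentiableOn 𝕜 (x k) T)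
    (hx_cont : ∀ k, ContinuousOn (deriv (x k)) T)
    -- the arcs, the constants and the branches of the weight on them
    (r : ℕ) (A : Fin r → ℂ) (γ : Fin r → 𝕜 → ℝ → ℂ) (ℓ : Fin r → Fin m → 𝕜 → ℝ → ℂ)
    (harc : ∀ j, Toda.IsJoiningArc T x α (γ j) (ℓ j) ∨ Toda.IsClosedContour T x α (γ j) (ℓ j))
    -- the orthonormal polynomials and their recurrence coefficients
    (p : 𝕜 → ℕ → ℂ[X]) (hp : ∀ t ∈ T, Toda.IsOrthonormal (Toda.moment α A γ ℓ t) (p t))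
    (a b : ℕ → 𝕜 → ℂ)
    (hab : ∀ t ∈ T, Toda.IsRecurrence (p t) (fun n => a n t) (fun n => b n t))
    -- the signs of the `aₙ` are chosen continuously
    (ha : ∀ n, 1 ≤ n → ContinuousOn (a n) T) :
    ∀ t ∈ T,
      Toda.FormalODE (fun k => x k t) α (Toda.moment α A γ ℓ t) ∧
      (∀ n, 1 ≤ n →
        a n t ≠ 0 ∧ DifferentiableAt 𝕜 (a n) t ∧
        deriv (a n) t / a n t = (1 / 2) * ∑ k,
          ((Toda.Theta (fun k => x k t) α (Toda.moment α A γ ℓ t) (p t) n).eval (x k t)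
            - (Toda.Theta (fun k => x k t) α (Toda.moment α A γ ℓ t) (p t) (n - 1)).eval (x k t))
            * deriv (x k) t / (derivative (Toda.W fun k => x k t)).eval (x k t)) ∧
      (∀ n,
        DifferentiableAt 𝕜 (b n) t ∧
        deriv (b n) t = ∑ k,
          ((Toda.Omega (fun k => x k t) α (Toda.moment α A γ ℓ t) (fun n => a n t) (p t)
              (n + 1)).eval (x k t)
            - (Toda.Omega (fun k => x k t) α (Toda.moment α A γ ℓ t) (fun n => a n t) (p t)
              n).eval (x k t))
            * deriv (x k) t / (derivative (Toda.W fun k => x k t)).eval (x k t)) := by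
  intro t ht
  obtain ⟨μ', hμ, hμ'⟩ := Toda.exists_hasDerivAt_moment (A := A) hT hx_diff hx_cont hx_inj harc ht
  refine ⟨(Toda.isPearson_moment hT hx_diff hx_inj harc ht).formalODE, fun n hn => ?_, fun n => ?_⟩
  · obtain ⟨n, rfl⟩ := Nat.exists_eq_add_of_le' hn
    have hd := Toda.hasDerivAt_recurrence_a hT hp hab ht hμ (n := n)
      ((ha (n + 1) hn).continuousAt (hT.mem_nhds ht))
    have h0 : a (n + 1) t ≠ 0 := (hab t ht).ne_zero (hp t ht) n
    refine ⟨h0, hd.differentiableAt, ?_⟩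
    rw [hd.deriv, mul_div_cancel_left₀ _ h0, hμ', hμ', ← Finset.sum_sub_distrib]
    congr 1
    refine Finset.sum_congr rfl fun k _ => ?_
    rw [Nat.add_sub_cancel, (hp t ht).eval_Theta (fun k => x k t) α (n + 1) k,
      (hp t ht).eval_Theta (fun k => x k t) α n k]
    ring
  · obtain ⟨b', hb, hsum⟩ := Toda.hasDerivAt_recurrence_b hT hp hab ht hμ
    refine ⟨(hb n).differentiableAt, ?_⟩
    rw [(hb n).deriv]
    -- The partial sums of the `ḃ_j` are measured from `Ω_0`, so that the empty sum fits as well;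
    -- consecutive differences then remove `Ω_0`.
    have key : ∀ n, ∑ j ∈ Finset.range n, b' j = ∑ k,
        ((Toda.Omega (fun k => x k t) α (Toda.moment α A γ ℓ t) (fun n => a n t) (p t)
            n).eval (x k t)
          - (Toda.Omega (fun k => x k t) α (Toda.moment α A γ ℓ t) (fun n => a n t) (p t)
            0).eval (x k t))
          * deriv (x k) t / (derivative (Toda.W fun k => x k t)).eval (x k t) := by
      intro n
      cases n with
      | zero => simp
      | succ n =>
        rw [hsum, hμ', Finset.mul_sum]
        refine Finset.sum_congr rfl fun k _ => ?_
        rw [(hp t ht).eval_Omega_succ (fun k => x k t) α (hab t ht) n k]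
        ring
    have h1 := Finset.sum_range_succ b' n
    rw [key, key, ← sub_eq_iff_eq_add', ← Finset.sum_sub_distrib] at h1
    rw [← h1]
    exact Finset.sum_congr rfl fun k _ => by ring
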